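/- Let $N\ge 1$, let $\mathbb X_1,\dots,\mathbb X_N$ be non-empty compact Polish spaces, $\mathbb X=\mathbb X_1\times\dots\times\mathbb X_N$, and let $\mu_i,\gamma_i$ be finite non-negative Borel measures on $\mathbb X_i$, where $\mu_i$ has full support. Let $c\in C(\mathbb X)$ be non-negative, $\varepsilon>0$, and let $\varphi_i:\mathbb R\to[0,\infty]$ be entropy functions, i.e. convex, lower semicontinuous, with $\varphi_i(1)=0$ and $\varphi_i=\infty$ on $(-\infty,0)$. Let $\varphi_i^*(q)=\sup_x\{qx-\varphi_i(x)\}$ be the Fenchel conjugate. Write $\gamma^\otimes=\bigotimes_i\gamma_i$, $\gamma_j^\otimes=\bigotimes_{i\ne j}\gamma_i$, $f^\oplus(x)=\sum_i f_i(x_i)$, $f_j^\oplus(x)=\sum_{i\neq j}f_i(x_i)$. The dual functional of regularized unbalanced multi-marginal optimal transport is, for $f=(f_1,\dots,f_N)\in\prod_i L^\infty(\mathbb X_i,\gamma_i)$, $$D(f)=-\sum_{i=1}^N\int\varphi_i^*(-f_i)\,d\mu_i-\varepsilon\int\Bigl(\exp\Bigl(\frac{f^\oplus-c}{\varepsilon}\Bigr)-1\Bigr)d\gamma^\otimes\in[-\infty,\infty).$$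 Assume $\mu_i\ll\gamma_i$ with density $\sigma_{\mu_i}=d\mu_i/d\gamma_i$ satisfying $\ln\sigma_{\mu_i}\in L^\infty(\mathbb X_i,\gamma_i)$ for all $i$. For $j=1,\dots,N$ set $$f^{(c,\varepsilon,j)}=\varepsilon\ln\sigma_{\mu_j}-\varepsilon\ln\int\exp\Bigl(\frac{f_j^\oplus-c}{\varepsilon}\Bigr)d\gamma_j^\otimes,\qquad f^{(c,\varepsilon,\varphi,j)}=-\operatorname{aprox}^\varepsilon_{\varphi_j^*}\bigl(-f^{(c,\varepsilon,j)}\bigr),$$ where $\operatorname{aprox}^\varepsilon_{\varphi_j^*}(p)=\operatorname{argmin}_{q\in\mathbb R}\{\varepsilon e^{(p-q)/\varepsilon}+\varphi_j^*(q)\}$ is applied pointwise. Starting from $f^{(0)}\in\prod_iL^\infty(\mathbb X_i,\gamma_i)$, the Sinkhorn iterates are defined for $r=0,1,\dots$ and $j=1,\dots,N$ by $f_j^{(rN+j)}=(f^{(rN+j-1)})^{(c,\varepsilon,\varphi,j)}$ and $f_i^{(rN+j)}=f_i^{(rN+j-1)}$ for $i\ne j$. **Theorem.** Assume in addition that every $\varphi_i^*$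 is strictly convex (on its domain), and that there are sequences $q_i^{(n)}\in\operatorname{dom}\varphi_i^*$ and $p_i^{(n)}\in\partial\varphi_i^*(q_i^{(n)})$, $i=1,\dots,N$, such that either $p_i^{(n)}\to+\infty$ as $n\to\infty$ for all $i$, or, for all $i$, $p_i^{(n)}\to0$ as $n\to\infty$ and $(p_i^{(n)})_n$ is not constant. Then all Sinkhorn iterates lie in $\prod_iL^\infty(\mathbb X_i,\gamma_i)$ and are uniformly bounded there, i.e. $\sup_{n,i}\|f_i^{(n)}\|_{L^\infty(\mathbb X_i,\gamma_i)}<\infty$; the functional $D$ has a maximizer $\hat f$ over $\prod_iL^\infty(\mathbb X_i,\gamma_i)$, unique up to $\gamma_i$-null sets; and $\|f_i^{(n)}-\hat f_i\|_{L^p(\mathbb X_i,\gamma_i)}\to0$ as $n\to\infty$ for every $i$ and every $p\in[1,\infty)$. -/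

import Mathlib

open MeasureTheory Filter Topology
open scoped ENNReal

noncomputable section

namespace UMOT

/-- An entropy function: a non-negative, convex, lower semicontinuous function
`φ : ℝ → [0, ∞]` with `φ 1 = 0` and `φ = ∞` on the negative half-line. -/
structure IsEntropyFunction (φ : ℝ → EReal) : Prop where
  nonneg : ∀ x, 0 ≤ φ x
  convex : ∀ x y a b : ℝ, 0 < a → 0 < b → a + b = 1 →
    φ (a * x + b * y) ≤ (a : EReal) * φ x + (b : EReal) * φ y
  lsc : LowerSemicontinuous φ
  map_one : φ 1 = 0
  eq_top_of_neg : ∀ x, x < 0 → φ x = ⊤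

/-- The Fenchel conjugate `F^*(q) = sup_x (q x - F x)`. -/
def conj (F : ℝ → EReal) (q : ℝ) : EReal :=
  ⨆ x : ℝ, ((q * x : ℝ) : EReal) - F x

/-- The domain of an extended real-valued function: the points where it is finite. -/
def dom (F : ℝ → EReal) : Set ℝ := {x | F x ≠ ⊤ ∧ F x ≠ ⊥}

/-- The subdifferential `∂F(x₀)`, empty if `x₀ ∉ dom F`. -/
def subdiff (F : ℝ → EReal) (x₀ : ℝ) : Set ℝ :=
  {p | x₀ ∈ dom F ∧ ∀ x : ℝ, F x₀ + ((p * (x - x₀) : ℝ) : EReal) ≤ F x}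

/-- Strict convexity of a function with values in `(-∞, ∞]`: strict convexity on its domain. -/
def IsStrictlyConvex (F : ℝ → EReal) : Prop :=
  StrictConvexOn ℝ (dom F) fun x => (F x).toReal

/-- The integral `∫ g dμ ∈ [-∞, ∞]` of an extended real-valued function, that is, the integral
of the positive part minus the integral of the negative part. -/
def extIntegral {α : Type*} [MeasurableSpace α] (μ : Measure α) (g : α → EReal) : EReal :=
  ((∫⁻ x, (g x).toENNReal ∂μ : ℝ≥0∞) : EReal) - ((∫⁻ x, (-g x).toENNReal ∂μ : ℝ≥0∞) : EReal)

/-- The anisotropic proximity operator of `F` (to be used with `F = φ^*`):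
`aprox F ε p = argmin_q (ε exp ((p - q) / ε) + F q)`. -/
def aprox (F : ℝ → EReal) (ε p : ℝ) : ℝ :=
  Classical.epsilon fun q : ℝ => ∀ q' : ℝ,
    ((ε * Real.exp ((p - q) / ε) : ℝ) : EReal) + F q ≤
      ((ε * Real.exp ((p - q') / ε) : ℝ) : EReal) + F q'

section Dual

variable {N : ℕ} {X : Fin N → Type*} [∀ i, MeasurableSpace (X i)]

/-- The dual functional
`f ↦ - ∑ i, ⟨μ_i, φ_i^*(-f_i)⟩ - ε ⟨γ^⊗, exp ((f^⊕ - c) / ε) - 1⟩`. -/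
def dualFunctional (μ γ : ∀ i, Measure (X i)) (φ : Fin N → ℝ → EReal) (c : (∀ i, X i) → ℝ)
    (ε : ℝ) (f : ∀ i, X i → ℝ) : EReal :=
  -(∑ i, extIntegral (μ i) fun x => conj (φ i) (-(f i x))) -
    ((ε * ∫ x, (Real.exp ((∑ i, f i (x i) - c x) / ε) - 1) ∂(Measure.pi γ) : ℝ) : EReal)

/-- `f` lies in `L^∞(X_1, γ_1) × ... × L^∞(X_N, γ_N)`. -/
def MemLinfty (γ : ∀ i, Measure (X i)) (f : ∀ i, X i → ℝ) : Prop :=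
  ∀ i, MemLp (f i) ∞ (γ i)

/-- `f` is a maximizer of the dual functional over `L^∞(X_1, γ_1) × ... × L^∞(X_N, γ_N)`. -/
def IsDualMaximizer (μ γ : ∀ i, Measure (X i)) (φ : Fin N → ℝ → EReal) (c : (∀ i, X i) → ℝ)
    (ε : ℝ) (f : ∀ i, X i → ℝ) : Prop :=
  MemLinfty γ f ∧ ∀ g : ∀ i, X i → ℝ, MemLinfty γ g →
    dualFunctional μ γ φ c ε g ≤ dualFunctional μ γ φ c ε f

/-- The `j`-th `(c, ε)`-transform
`ε ln (dμ_j/dγ_j) - ε ln (∫ exp ((⊕_{i ≠ j} f_i - c) / ε) d(⊗_{i ≠ j} γ_i))`;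
`(Equiv.piSplitAt j X).symm (t, y)` is the point of the product with `j`-th coordinate `t`
and the other coordinates `y`. -/
def ceTransform (μ γ : ∀ i, Measure (X i)) (c : (∀ i, X i) → ℝ) (ε : ℝ)
    (f : ∀ i, X i → ℝ) (j : Fin N) (t : X j) : ℝ :=
  ε * Real.log ((μ j).rnDeriv (γ j) t).toReal -
    ε * Real.log (∫ y : (∀ i : {i // i ≠ j}, X i),
      Real.exp ((∑ i : {i // i ≠ j}, f i (y i) - c ((Equiv.piSplitAt j X).symm (t, y))) / ε)
        ∂(Measure.pi fun i : {i // i ≠ j} => γ i))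

/-- The `j`-th Sinkhorn mapping, `f ↦ - aprox (- f^(c,ε,j))`. -/
def sinkhornMap (μ γ : ∀ i, Measure (X i)) (φ : Fin N → ℝ → EReal) (c : (∀ i, X i) → ℝ)
    (ε : ℝ) (f : ∀ i, X i → ℝ) (j : Fin N) (t : X j) : ℝ :=
  -aprox (conj (φ j)) ε (-ceTransform μ γ c ε f j t)

/-- The Sinkhorn iterates started at `f₀`: step `n → n + 1` replaces the coordinate with
(zero-based) index `n mod N` by its Sinkhorn mapping and keeps the others. -/
def sinkhornSeq [NeZero N] (μ γ : ∀ i, Measure (X i)) (φ : Fin N → ℝ → EReal)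
    (c : (∀ i, X i) → ℝ) (ε : ℝ) (f₀ : ∀ i, X i → ℝ) : ℕ → ∀ i, X i → ℝ
  | 0 => f₀
  | n + 1 => Function.update (sinkhornSeq μ γ φ c ε f₀ n) (Fin.ofNat N n)
      (sinkhornMap μ γ φ c ε (sinkhornSeq μ γ φ c ε f₀ n) (Fin.ofNat N n))

end Dual

end UMOT

end

/-!
The Sinkhorn iteration is block-coordinate ascent for the concave dual functional, and everything
rests on a first-order description of one step. By optimality in the definition of `aprox`
(`aprox_subgradient`), the new potential `f_j` comes with a subgradient of `φ_j^*` at `-f_j` which,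
weighted with the density of `μ_j`, is the `j`-th marginal of the plan `π = exp ((f^⊕ - c) / ε)`
(`density_mul_sinkhornSlope`). Integration gives a variational inequality
(`integral_penalty_sinkhornStep_le`): `f_j` minimizes `g ↦ ∫ φ_j^*(-g) dμ_j - ∫ g(x_j) π dγ^⊗`.
Since the Bregman divergence of `exp` dominates the squared difference of square roots, each step
raises the dual functional by at least `ε ∫ (√π - √π')² dγ^⊗`
(`realDual_add_sq_le_sinkhornStep`).

*Boundedness.* The cost and the densities are bounded and `aprox` is non-expansive, so all updated
potentials have a common bound on their oscillation (`exists_abs_sinkhornMap_sub_le`). It remains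
to bound constants `a_i` near the potentials. The slopes of `φ_i^*` include `1`, and by assumption
either arbitrarily large ones for all `i` or arbitrarily small ones for all `i`. Hence
`-μ_i(X_i) φ_i^*(-a) ≤ min (A a) (B a) + const` with `A < B` independent of `i`. Together with the
exponential term, which bounds `∑ a_i` from above, this makes superlevel sets of the dual functional
bounded (`exists_abs_center_le`), and the iterates stay in one.

*Maximizing sequence.* The dual values increase and are bounded, so they converge, and consecutive
plans become close in the Hellinger distance and thus in `L¹`. At the end of a cycle every
coordinate satisfies its variational inequality with a plan that is nearly the current one; summing
these inequalities shows that the limit of the dual values is at least the value at any competitor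
(`IsSinkhornSeq.realDual_le_limitValue_of_admissible`).

*Convergence.* Strict convexity of `φ_i^*` bounds `|a - b|` on bounded sets by `δ` plus a multiple of
the gap in midpoint convexity (`exists_abs_sub_le_add_mul_midGap`). Comparing two nearly optimal
potentials with their midpoint therefore shows that they are close in `L¹`
(`exists_integral_abs_sub_le`). This makes the iterates a Cauchy sequence, and maximizers unique.
The subgradients at the iterates are uniformly bounded, so the penalties pass to the limit
(`IsSinkhornSeq.exists_limit`), which is a maximizer; by boundedness, `L¹`-convergence is
`L^p`-convergence for every `p < ∞`. Neither equicontinuity nor compactness of the transforms is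
needed: apart from measurability only the boundedness of `c` enters.
-/

noncomputable section

namespace UMOT

/-! ### Convex functions of one real variable -/

/-- The defect `h a / 2 + h b / 2 - h ((a + b) / 2)` in midpoint convexity. -/
def midGap (h : ℝ → ℝ) (a b : ℝ) : ℝ := h a / 2 + h b / 2 - h ((a + b) / 2)

theorem midGap_comm (h : ℝ → ℝ) (a b : ℝ) : midGap h a b = midGap h b a := by
  simp only [midGap, add_comm a b]; ring

theorem midGap_nonneg {D : Set ℝ} {h : ℝ → ℝ} (hc : ConvexOn ℝ D h) {a b : ℝ}
    (ha : a ∈ D) (hb : b ∈ D) : 0 ≤ midGap h a b := by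
  have := hc.2 ha hb (by norm_num : (0 : ℝ) ≤ 1 / 2) (by norm_num : (0 : ℝ) ≤ 1 / 2) (by norm_num)
  simp only [smul_eq_mul] at this
  rw [show (1 / 2 * a + 1 / 2 * b : ℝ) = (a + b) / 2 by ring] at this
  unfold midGap; linarith

theorem midGap_pos {D : Set ℝ} {h : ℝ → ℝ} (hc : StrictConvexOn ℝ D h) {a b : ℝ}
    (ha : a ∈ D) (hb : b ∈ D) (hab : a ≠ b) : 0 < midGap h a b := by
  have := hc.2 ha hb hab (by norm_num : (0 : ℝ) < 1 / 2) (by norm_num : (0 : ℝ) < 1 / 2)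
    (by norm_num)
  simp only [smul_eq_mul] at this
  rw [show (1 / 2 * a + 1 / 2 * b : ℝ) = (a + b) / 2 by ring] at this
  unfold midGap; linarith

theorem midpoint_mem_of_convex {D : Set ℝ} (hD : Convex ℝ D) {a b : ℝ}
    (ha : a ∈ D) (hb : b ∈ D) : (a + b) / 2 ∈ D := by
  have := hD ha hb (by norm_num : (0 : ℝ) ≤ 1 / 2) (by norm_num : (0 : ℝ) ≤ 1 / 2) (by norm_num)
  simp only [smul_eq_mul] at this
  rwa [show (1 / 2 * a + 1 / 2 * b : ℝ) = (a + b) / 2 by ring] at this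

/-- Moving one end of an interval inwards decreases the midpoint gap: the points
`(a + b) / 2` (twice) and `b'` have the same barycentre as `(a + b') / 2` (twice) and `b`, and they
lie between these. -/
theorem midGap_lineMap_le {D : Set ℝ} {h : ℝ → ℝ} (hc : ConvexOn ℝ D h) {a b θ : ℝ}
    (ha : a ∈ D) (hb : b ∈ D) (h0 : 0 ≤ θ) (h1 : θ ≤ 1) :
    midGap h a (a + θ * (b - a)) ≤ midGap h a b := by
  have hw : 0 < 2 - θ := by linarith
  have hb' : a + θ * (b - a) ∈ D := by
    have := hc.1 ha hb (by linarith : 0 ≤ 1 - θ) h0 (by ring)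
    simp only [smul_eq_mul] at this
    rwa [show (1 - θ) * a + θ * b = a + θ * (b - a) by ring] at this
  have hm' := midpoint_mem_of_convex hc.1 ha hb'
  have e1 := hc.2 hm' hb (show (0 : ℝ) ≤ 1 / (2 - θ) by positivity)
    (show 0 ≤ (1 - θ) / (2 - θ) from div_nonneg (by linarith) hw.le) (by field_simp; ring)
  have e2 := hc.2 hm' hb
    (show 0 ≤ (2 - 2 * θ) / (2 - θ) from div_nonneg (by linarith) hw.le)
    (show 0 ≤ θ / (2 - θ) by positivity) (by field_simp; ring)
  simp only [smul_eq_mul] at e1 e2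
  rw [show 1 / (2 - θ) * ((a + (a + θ * (b - a))) / 2) + (1 - θ) / (2 - θ) * b = (a + b) / 2 by
    field_simp; ring] at e1
  rw [show (2 - 2 * θ) / (2 - θ) * ((a + (a + θ * (b - a))) / 2) + θ / (2 - θ) * b
    = a + θ * (b - a) by field_simp; ring] at e2
  have e3 : 1 / (2 - θ) * 2 + (2 - 2 * θ) / (2 - θ) = 2 := by field_simp; ring
  have e4 : (1 - θ) / (2 - θ) * 2 + θ / (2 - θ) = 1 := by field_simp; ring
  have e5 : 2 * h ((a + b) / 2) + h (a + θ * (b - a)) ≤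
      (1 / (2 - θ) * 2 + (2 - 2 * θ) / (2 - θ)) * h ((a + (a + θ * (b - a))) / 2) +
      ((1 - θ) / (2 - θ) * 2 + θ / (2 - θ)) * h b := by linarith
  rw [e3, e4] at e5
  unfold midGap; linarith

theorem midGap_mono {D : Set ℝ} {h : ℝ → ℝ} (hc : ConvexOn ℝ D h) {a a' b' b : ℝ}
    (ha : a ∈ D) (hb : b ∈ D) (h1 : a ≤ a') (h2 : a' < b') (h3 : b' ≤ b) :
    midGap h a' b' ≤ midGap h a b := by
  have hab : 0 < b - a := by linarith
  have hab' : 0 < b' - a := by linarith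
  have hb' : b' ∈ D := hc.1.ordConnected.out ha hb ⟨by linarith, h3⟩
  have s1 := midGap_lineMap_le hc ha hb (θ := (b' - a) / (b - a)) (by positivity)
    (by rw [div_le_one hab]; linarith)
  rw [div_mul_cancel₀ _ hab.ne', add_sub_cancel] at s1
  have s2 := midGap_lineMap_le hc hb' ha (θ := (b' - a') / (b' - a))
    (div_nonneg (by linarith) hab'.le) (by rw [div_le_one hab']; linarith)
  rw [show b' + (b' - a') / (b' - a) * (a - b') = a' by field_simp; ring] at s2
  rw [midGap_comm, midGap_comm h b' a] at s2
  exact s2.trans s1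

/-- A strictly convex function controls distances on bounded sets through its midpoint gap. As
gaps shrink with the interval, it suffices to consider the finitely many intervals of a grid. -/
theorem exists_abs_sub_le_add_mul_midGap {D : Set ℝ} {h : ℝ → ℝ} (hs : StrictConvexOn ℝ D h)
    (M : ℝ) {δ : ℝ} (hδ : 0 < δ) :
    ∃ K : ℝ, 0 ≤ K ∧ ∀ a ∈ D, ∀ b ∈ D, |a| ≤ M → |b| ≤ M → |a - b| ≤ δ + K * midGap h a b := by
  classical
  let x : ℕ → ℝ := fun k => -M + k * (δ / 2)
  let n : ℕ := ⌈4 * |M| / δ⌉₊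
  let w : ℕ → ℝ := fun k =>
    if x k ∈ D ∧ x (k + 1) ∈ D then 2 * |M| / midGap h (x k) (x (k + 1)) else 0
  have hx : ∀ k, x k < x (k + 1) := fun k => by simp only [x]; push_cast; linarith
  have hw : ∀ k, 0 ≤ w k := fun k => by
    simp only [w]
    split_ifs with hk
    · exact div_nonneg (by positivity) (midGap_nonneg hs.convexOn hk.1 hk.2)
    · exact le_rfl
  refine ⟨∑ k ∈ Finset.range n, w k, Finset.sum_nonneg fun k _ => hw k, ?_⟩
  have key : ∀ a ∈ D, ∀ b ∈ D, |a| ≤ M → |b| ≤ M → a ≤ b →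
      |a - b| ≤ δ + (∑ k ∈ Finset.range n, w k) * midGap h a b := by
    intro a ha b hb haM hbM hab
    have hG := midGap_nonneg hs.convexOn ha hb
    have hK := Finset.sum_nonneg fun k (_ : k ∈ Finset.range n) => hw k
    rw [abs_sub_comm, abs_of_nonneg (by linarith)]
    rcases le_or_gt (b - a) δ with hle | hgt
    · have := mul_nonneg hK hG; linarith
    obtain ⟨ha1, ha2⟩ := abs_le.1 haM
    obtain ⟨hb1, hb2⟩ := abs_le.1 hbM
    have hM : 0 ≤ M := by linarith
    set k := ⌈(a + M) / (δ / 2)⌉₊ with hk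
    have hk1 : a ≤ x k := by
      have := Nat.le_ceil ((a + M) / (δ / 2))
      rw [← hk, div_le_iff₀ (by positivity)] at this
      simp only [x]; linarith
    have hk2 : x k < a + δ / 2 := by
      have := Nat.ceil_lt_add_one (a := (a + M) / (δ / 2)) (by apply div_nonneg <;> linarith)
      rw [← hk, ← sub_lt_iff_lt_add, lt_div_iff₀ (by positivity)] at this
      simp only [x]; linarith
    have hk3 : x (k + 1) ≤ b := by
      have : x (k + 1) = x k + δ / 2 := by simp only [x]; push_cast; ring
      linarith
    have hkn : k < n := by
      have h1 : (k : ℝ) < 4 * |M| / δ := by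
        rw [lt_div_iff₀ hδ, abs_of_nonneg hM]
        have : x k < M := (hx k).trans_le (hk3.trans hb2)
        simp only [x] at this; linarith
      exact_mod_cast h1.trans_le (Nat.le_ceil _)
    have hD1 : x k ∈ D := hs.1.ordConnected.out ha hb ⟨hk1, by linarith [hx k]⟩
    have hD2 : x (k + 1) ∈ D := hs.1.ordConnected.out ha hb ⟨by linarith [hx k], hk3⟩
    have hg := midGap_pos hs hD1 hD2 (hx k).ne
    have hmono := midGap_mono hs.convexOn ha hb hk1 (hx k) hk3
    have h2 : w k * midGap h (x k) (x (k + 1)) = 2 * M := by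
      simp only [w, hD1, hD2, and_self, if_true, abs_of_nonneg hM]
      field_simp
    have h3 : w k ≤ ∑ k ∈ Finset.range n, w k :=
      Finset.single_le_sum (fun i _ => hw i) (Finset.mem_range.2 hkn)
    have h4 : 2 * M ≤ (∑ k ∈ Finset.range n, w k) * midGap h a b :=
      h2 ▸ mul_le_mul h3 hmono hg.le hK
    linarith
  intro a ha b hb haM hbM
  rcases le_total a b with hab | hab
  · exact key a ha b hb haM hbM hab
  · rw [abs_sub_comm, midGap_comm]; exact key b hb a ha hbM haM hab

/-! ### Conjugates of entropy functions -/

section Conjugate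

variable {φ : ℝ → EReal}

theorem le_conj (hφ : IsEntropyFunction φ) (q : ℝ) : (q : EReal) ≤ conj φ q := by
  have : ((q * 1 : ℝ) : EReal) - φ 1 ≤ conj φ q :=
    le_iSup (fun x : ℝ => ((q * x : ℝ) : EReal) - φ x) 1
  simpa only [hφ.map_one, mul_one, sub_zero] using this

theorem conj_ne_bot (hφ : IsEntropyFunction φ) (q : ℝ) : conj φ q ≠ ⊥ := fun h => by
  have := le_conj hφ q
  rw [h, le_bot_iff] at this
  exact EReal.coe_ne_bot _ this

theorem conj_zero (hφ : IsEntropyFunction φ) : conj φ 0 = 0 := by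
  apply le_antisymm
  · refine iSup_le fun x => ?_
    have := hφ.nonneg x
    simpa using this
  · simpa using le_conj hφ 0

theorem mem_dom_conj_iff (hφ : IsEntropyFunction φ) {q : ℝ} :
    q ∈ dom (conj φ) ↔ conj φ q ≠ ⊤ :=
  ⟨fun h => h.1, fun h => ⟨h, conj_ne_bot hφ q⟩⟩

theorem zero_mem_dom_conj (hφ : IsEntropyFunction φ) : (0 : ℝ) ∈ dom (conj φ) := by
  rw [mem_dom_conj_iff hφ, conj_zero hφ]; exact EReal.zero_ne_top

theorem coe_toReal_conj {q : ℝ} (hq : q ∈ dom (conj φ)) :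
    (((conj φ q).toReal : ℝ) : EReal) = conj φ q :=
  EReal.coe_toReal hq.1 hq.2

theorem le_toReal_conj (hφ : IsEntropyFunction φ) {q : ℝ} (hq : q ∈ dom (conj φ)) :
    q ≤ (conj φ q).toReal := by
  have := le_conj hφ q
  rw [← coe_toReal_conj hq] at this
  exact_mod_cast this

theorem conj_le_coe_iff (hφ : IsEntropyFunction φ) {q r : ℝ} :
    conj φ q ≤ r ↔ ∀ x, φ x ≠ ⊤ → q * x - (φ x).toReal ≤ r := by
  have hb : ∀ x, φ x ≠ ⊥ := fun x h => by
    have := hφ.nonneg x; rw [h] at this; simp at this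
  unfold conj
  rw [iSup_le_iff]
  refine forall_congr' fun x => ?_
  by_cases hx : φ x = ⊤
  · simp [hx]
  · simp only [ne_eq, hx, not_false_eq_true, true_imp_iff]
    conv_lhs => rw [← EReal.coe_toReal hx (hb x)]
    exact_mod_cast Iff.rfl

theorem lowerSemicontinuous_conj (hφ : IsEntropyFunction φ) : LowerSemicontinuous (conj φ) := by
  have hb : ∀ x, φ x ≠ ⊥ := fun x h => by
    have := hφ.nonneg x; rw [h] at this; simp at this
  refine lowerSemicontinuous_iSup fun x => ?_
  by_cases hx : φ x = ⊤
  · simp only [hx, EReal.sub_top]; exact lowerSemicontinuous_const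
  · rw [← EReal.coe_toReal hx (hb x)]
    apply Continuous.lowerSemicontinuous
    have : Continuous fun q : ℝ => ((q * x - (φ x).toReal : ℝ) : EReal) :=
      continuous_coe_real_ereal.comp (by fun_prop)
    simpa using this

/-! ### The anisotropic proximity operator -/

/-- The minimization problem that defines `aprox` has a solution: its objective is lower
semicontinuous and coercive, as `q ≤ φ^* q`. -/
theorem exists_forall_aprox_objective_le (hφ : IsEntropyFunction φ) {ε : ℝ} (hε : 0 < ε) (p : ℝ) :
    ∃ q : ℝ, ∀ q' : ℝ, ((ε * Real.exp ((p - q) / ε) : ℝ) : EReal) + conj φ q ≤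
      ((ε * Real.exp ((p - q') / ε) : ℝ) : EReal) + conj φ q' := by
  let H : ℝ → EReal := fun q => ((ε * Real.exp ((p - q) / ε) : ℝ) : EReal) + conj φ q
  have hcont : Continuous fun q : ℝ => ((ε * Real.exp ((p - q) / ε) : ℝ) : EReal) :=
    continuous_coe_real_ereal.comp (by fun_prop)
  have hlsc : LowerSemicontinuous H := by
    refine LowerSemicontinuous.add' hcont.lowerSemicontinuous (lowerSemicontinuous_conj hφ) ?_
    intro x
    exact EReal.continuousAt_add (Or.inl (EReal.coe_ne_top _)) (Or.inl (EReal.coe_ne_bot _))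
  -- outside `[-b, b]` the objective exceeds its value at `0`
  set v : ℝ := ε * Real.exp (p / ε) with hv
  have hH0 : H 0 = v := by simp [H, conj_zero hφ, hv]
  have hvpos : 0 < v := by positivity
  set b : ℝ := v + 2 * |p| + 4 * ε
  have hb : 0 ≤ b := by positivity
  have hout : ∀ q, q ∉ Set.Icc (-b) b → H 0 ≤ H q := by
    intro q hq
    have h1 : ((ε * Real.exp ((p - q) / ε) + q : ℝ) : EReal) ≤ H q := by
      rw [EReal.coe_add]; exact add_le_add_right (le_conj hφ q) _
    rw [hH0]
    refine le_trans ?_ h1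
    rw [EReal.coe_le_coe_iff]
    rw [Set.mem_Icc, not_and_or, not_le, not_le] at hq
    rcases hq with hq | hq
    · have hpos : 0 ≤ (p - q) / ε := by
        apply div_nonneg _ hε.le
        have := neg_abs_le p; linarith [abs_nonneg p]
      have h2 := Real.quadratic_le_exp_of_nonneg hpos
      have h3 : ε * Real.exp ((p - q) / ε) ≥ ε * (1 + (p - q) / ε + ((p - q) / ε) ^ 2 / 2) :=
        mul_le_mul_of_nonneg_left h2 hε.le
      have h4 : ε * (1 + (p - q) / ε + ((p - q) / ε) ^ 2 / 2) =
          ε + (p - q) + (p - q) * ((p - q) / ε) / 2 := by field_simp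
      have h5 : 4 ≤ (p - q) / ε := by
        rw [le_div_iff₀ hε]; have := neg_abs_le p; linarith [abs_nonneg p]
      have h6 : (p - q) * 4 ≤ (p - q) * ((p - q) / ε) :=
        mul_le_mul_of_nonneg_left h5 (by have := neg_abs_le p; linarith [abs_nonneg p])
      have := neg_abs_le p
      linarith [abs_nonneg p]
    · have : 0 < ε * Real.exp ((p - q) / ε) := by positivity
      linarith [abs_nonneg p]
  obtain ⟨q, hq, hmin⟩ := (hlsc.lowerSemicontinuousOn (Set.Icc (-b) b)).exists_isMinOn
    ⟨0, by constructor <;> linarith⟩ isCompact_Icc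
  refine ⟨q, fun q' => ?_⟩
  by_cases h' : q' ∈ Set.Icc (-b) b
  · exact hmin h'
  · exact (hmin (by constructor <;> linarith : (0 : ℝ) ∈ Set.Icc (-b) b)).trans (hout q' h')

theorem aprox_objective_le (hφ : IsEntropyFunction φ) {ε : ℝ} (hε : 0 < ε) (p q : ℝ) :
    ((ε * Real.exp ((p - aprox (conj φ) ε p) / ε) : ℝ) : EReal) + conj φ (aprox (conj φ) ε p) ≤
      ((ε * Real.exp ((p - q) / ε) : ℝ) : EReal) + conj φ q :=
  Classical.epsilon_spec (exists_forall_aprox_objective_le hφ hε p) q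

theorem aprox_mem_dom (hφ : IsEntropyFunction φ) {ε : ℝ} (hε : 0 < ε) (p : ℝ) :
    aprox (conj φ) ε p ∈ dom (conj φ) := by
  rw [mem_dom_conj_iff hφ]
  intro h
  have := aprox_objective_le hφ hε p 0
  rw [h, conj_zero hφ, EReal.coe_add_top, add_zero, top_le_iff] at this
  exact EReal.coe_ne_top _ this

/-- First-order optimality: `exp ((p - q) / ε)` is a subgradient of `φ^*` at `q = aprox p`. -/
theorem aprox_subgradient (hφ : IsEntropyFunction φ) (hconv : IsStrictlyConvex (conj φ))
    {ε : ℝ} (hε : 0 < ε) (p : ℝ) {q : ℝ} (hq : q ∈ dom (conj φ)) :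
    (conj φ (aprox (conj φ) ε p)).toReal +
        Real.exp ((p - aprox (conj φ) ε p) / ε) * (q - aprox (conj φ) ε p) ≤
      (conj φ q).toReal := by
  set q₀ := aprox (conj φ) ε p with hq₀
  have hdom : q₀ ∈ dom (conj φ) := aprox_mem_dom hφ hε p
  -- comparison with the point `q₀ + t (q - q₀)`, by convexity of `exp`
  have key : ∀ t : ℝ, 0 < t → t ≤ 1 →
      (conj φ q₀).toReal + Real.exp ((p - (q₀ + t * (q - q₀))) / ε) * (q - q₀) ≤
        (conj φ q).toReal := by
    intro t ht0 ht1
    have hcv := hconv.convexOn.2 hdom hq (by linarith : 0 ≤ 1 - t) ht0.le (by ring)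
    have hmem := hconv.1 hdom hq (by linarith : 0 ≤ 1 - t) ht0.le (by ring)
    simp only [smul_eq_mul] at hcv hmem
    rw [show (1 - t) * q₀ + t * q = q₀ + t * (q - q₀) by ring] at hcv hmem
    have hmin := aprox_objective_le hφ hε p (q₀ + t * (q - q₀))
    rw [← hq₀, ← coe_toReal_conj hdom, ← coe_toReal_conj hmem] at hmin
    norm_cast at hmin
    set e := Real.exp ((p - (q₀ + t * (q - q₀))) / ε) with he
    have hexp : e * (1 + t * (q - q₀) / ε) ≤ Real.exp ((p - q₀) / ε) := by
      have h1 : Real.exp ((p - q₀) / ε) = e * Real.exp (t * (q - q₀) / ε) := by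
        rw [he, ← Real.exp_add]; congr 1; ring
      rw [h1]
      exact mul_le_mul_of_nonneg_left (by linarith [Real.add_one_le_exp (t * (q - q₀) / ε)])
        (Real.exp_pos _).le
    have hexp2 : ε * e + e * (t * (q - q₀)) ≤ ε * Real.exp ((p - q₀) / ε) := by
      have := mul_le_mul_of_nonneg_left hexp hε.le
      calc ε * e + e * (t * (q - q₀)) = ε * (e * (1 + t * (q - q₀) / ε)) := by field_simp
        _ ≤ _ := this
    have : t * ((conj φ q₀).toReal + e * (q - q₀)) ≤ t * (conj φ q).toReal := by nlinarith
    exact le_of_mul_le_mul_left this ht0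
  have hlim : Tendsto (fun t : ℝ => (conj φ q₀).toReal +
      Real.exp ((p - (q₀ + t * (q - q₀))) / ε) * (q - q₀)) (𝓝[>] 0)
      (𝓝 ((conj φ q₀).toReal + Real.exp ((p - q₀) / ε) * (q - q₀))) := by
    have hc : Continuous fun t : ℝ => (conj φ q₀).toReal +
      Real.exp ((p - (q₀ + t * (q - q₀))) / ε) * (q - q₀) := by fun_prop
    have := (hc.tendsto 0).mono_left (nhdsWithin_le_nhds (s := Set.Ioi 0))
    simpa using this
  refine le_of_tendsto hlim ?_
  filter_upwards [Ioc_mem_nhdsGT (show (0 : ℝ) < 1 by norm_num)] with t ht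
  exact key t ht.1 ht.2

/-- The proximity operator is non-expansive: subgradients of `φ^*` are monotone, so that both
`aprox p` and `p - aprox p` are non-decreasing in `p`. -/
theorem abs_aprox_sub_aprox_le (hφ : IsEntropyFunction φ) (hconv : IsStrictlyConvex (conj φ))
    {ε : ℝ} (hε : 0 < ε) (p₁ p₂ : ℝ) :
    |aprox (conj φ) ε p₁ - aprox (conj φ) ε p₂| ≤ |p₁ - p₂| := by
  have key : ∀ p₁ p₂, aprox (conj φ) ε p₁ - aprox (conj φ) ε p₂ ≤ |p₁ - p₂| := by
    intro p₁ p₂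
    have h1 := aprox_subgradient hφ hconv hε p₁ (aprox_mem_dom hφ hε p₂)
    have h2 := aprox_subgradient hφ hconv hε p₂ (aprox_mem_dom hφ hε p₁)
    set q₁ := aprox (conj φ) ε p₁
    set q₂ := aprox (conj φ) ε p₂
    rcases le_or_gt q₁ q₂ with hle | hgt
    · linarith [abs_nonneg (p₁ - p₂)]
    have h3 : Real.exp ((p₂ - q₂) / ε) * (q₁ - q₂) ≤ Real.exp ((p₁ - q₁) / ε) * (q₁ - q₂) := by
      linarith
    have h4 := Real.exp_le_exp.1 (le_of_mul_le_mul_right h3 (by linarith))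
    rw [div_le_div_iff_of_pos_right hε] at h4
    linarith [le_abs_self (p₁ - p₂)]
  rw [abs_le]
  constructor
  · have := key p₂ p₁; rw [abs_sub_comm] at this; linarith
  · exact key p₁ p₂

theorem continuous_aprox (hφ : IsEntropyFunction φ) (hconv : IsStrictlyConvex (conj φ))
    {ε : ℝ} (hε : 0 < ε) : Continuous (aprox (conj φ) ε) := by
  have : LipschitzWith 1 (aprox (conj φ) ε) := LipschitzWith.of_dist_le_mul fun x y => by
    simpa [Real.dist_eq] using abs_aprox_sub_aprox_le hφ hconv hε x y
  exact this.continuous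

end Conjugate

/-! ### Coercivity -/

/-- An exponential with positive rate dominates every affine function. -/
theorem exists_mul_sub_exp_le (T : ℝ) (hT : 0 < T) {κ ε : ℝ} (hκ : 0 < κ) (hε : 0 < ε) :
    ∃ C : ℝ, ∀ S : ℝ, T * S - κ * Real.exp (S / ε) ≤ C := by
  -- the tangent of slope `T` touches where `κ exp θ = T ε`
  set θ := Real.log (T * ε / κ) with hθ
  have hexp : κ * Real.exp θ = T * ε := by
    rw [hθ, Real.exp_log (by positivity)]; field_simp
  refine ⟨T * ε * (θ - 1), fun S => ?_⟩
  have h1 := Real.add_one_le_exp (S / ε - θ)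
  have h2 : κ * Real.exp (S / ε) = T * ε * Real.exp (S / ε - θ) := by
    rw [← hexp, mul_assoc, ← Real.exp_add]; congr 2; ring
  have h3 := mul_le_mul_of_nonneg_left h1 (by positivity : 0 ≤ T * ε)
  have h4 : T * ε * (S / ε - θ + 1) = T * S - T * ε * (θ - 1) := by field_simp; ring
  linarith

/-- If losses (slope `B` on the negative half-line) outweigh gains (slope `A < B` on the positive
half-line) and the sum is kept from growing by an exponential, superlevel sets are bounded. -/
theorem exists_abs_le_of_le_sum_min_sub_exp {ι : Type*} [Fintype ι] {A B κ ε : ℝ} (hA : 0 < A)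
    (hAB : A < B) (hκ : 0 < κ) (hε : 0 < ε) (d : ℝ) :
    ∃ M : ℝ, ∀ a : ι → ℝ,
      d ≤ ∑ i, min (A * a i) (B * a i) - κ * Real.exp ((∑ i, a i) / ε) → ∀ i, |a i| ≤ M := by
  classical
  obtain ⟨C₁, hC₁⟩ := exists_mul_sub_exp_le A hA hκ hε
  obtain ⟨C₂, hC₂⟩ := exists_mul_sub_exp_le (A + 1) (by linarith) hκ hε
  have hBA : 0 < B - A := by linarith
  refine ⟨|C₂ - d| + (C₁ - d) / (B - A), fun a ha i => ?_⟩
  have hmin : ∀ i, min (A * a i) (B * a i) = A * a i - (B - A) * max (-a i) 0 := fun i => by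
    rcases le_total 0 (a i) with h | h
    · rw [max_eq_right (by linarith), min_eq_left (by nlinarith)]; ring
    · rw [max_eq_left (by linarith), min_eq_right (by nlinarith)]; ring
  simp only [hmin, Finset.sum_sub_distrib, ← Finset.mul_sum] at ha
  have hneg : ∀ k, 0 ≤ max (-a k) 0 := fun k => le_max_right _ _
  have hsum : ∀ k, max (-a k) 0 ≤ ∑ i, max (-a i) 0 := fun k =>
    Finset.single_le_sum (fun k _ => hneg k) (Finset.mem_univ k)
  have hN : ∑ i, max (-a i) 0 ≤ (C₁ - d) / (B - A) := by
    rw [le_div_iff₀ hBA]; have := hC₁ (∑ i, a i); linarith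
  have hN0 : 0 ≤ (B - A) * ∑ i, max (-a i) 0 :=
    mul_nonneg hBA.le (Finset.sum_nonneg fun k _ => hneg k)
  have hS : ∑ i, a i ≤ C₂ - d := by have := hC₂ (∑ i, a i); linarith
  rw [abs_le]
  constructor
  · have := le_max_left (-a i) 0
    linarith [abs_nonneg (C₂ - d), hsum i]
  · have h1 : a i + max (-a i) 0 ≤ ∑ k, (a k + max (-a k) 0) :=
      Finset.single_le_sum (f := fun k => a k + max (-a k) 0)
        (fun k _ => by linarith [le_max_left (-a k) 0]) (Finset.mem_univ i)
    rw [Finset.sum_add_distrib] at h1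
    linarith [le_abs_self (C₂ - d), hneg i]

theorem toReal_conj_ge_of_mem_subdiff {φ : ℝ → EReal} {p q₀ q : ℝ}
    (hp : p ∈ subdiff (conj φ) q₀) (hq : q ∈ dom (conj φ)) :
    (conj φ q₀).toReal + p * (q - q₀) ≤ (conj φ q).toReal := by
  have := hp.2 q
  rw [← coe_toReal_conj hp.1, ← coe_toReal_conj hq] at this
  exact_mod_cast this

/-- Two affine minorants of `φ^*` with slopes `l` and `b` bound `-m φ^*(q)` by the minimum of two
linear functions of `-q`. -/
theorem neg_mul_toReal_conj_le_min {φ : ℝ → EReal} {m A B l b q₁ q₂ q : ℝ}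
    (hm : 0 ≤ m) (hAB : A ≤ B) (hl : m * l ≤ A) (hb : B ≤ m * b)
    (h₁ : l ∈ subdiff (conj φ) q₁) (h₂ : b ∈ subdiff (conj φ) q₂) (hq : q ∈ dom (conj φ)) :
    -(m * (conj φ q).toReal) ≤ min (A * -q) (B * -q) +
      m * (|(conj φ q₁).toReal - l * q₁| + |(conj φ q₂).toReal - b * q₂|) := by
  have e1 := mul_le_mul_of_nonneg_left (toReal_conj_ge_of_mem_subdiff h₁ hq) hm
  have e2 := mul_le_mul_of_nonneg_left (toReal_conj_ge_of_mem_subdiff h₂ hq) hm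
  have a1 := mul_le_mul_of_nonneg_left (neg_abs_le ((conj φ q₁).toReal - l * q₁)) hm
  have a2 := mul_le_mul_of_nonneg_left (neg_abs_le ((conj φ q₂).toReal - b * q₂)) hm
  have b1 := mul_nonneg hm (abs_nonneg ((conj φ q₁).toReal - l * q₁))
  have b2 := mul_nonneg hm (abs_nonneg ((conj φ q₂).toReal - b * q₂))
  rcases le_total q 0 with h | h
  · rw [min_eq_left (by nlinarith)]; nlinarith
  · rw [min_eq_right (by nlinarith)]; nlinarith

theorem one_mem_subdiff_conj_zero {φ : ℝ → EReal} (hφ : IsEntropyFunction φ) :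
    (1 : ℝ) ∈ subdiff (conj φ) 0 :=
  ⟨zero_mem_dom_conj hφ, fun x => by simpa [conj_zero hφ] using le_conj hφ x⟩

/-- The growth condition on the conjugates. As `1 ∈ ∂φ_i^*(0)`, subgradients tending to `+∞`
supply the steep minorants and subgradients tending to `0` the flat ones. -/
theorem exists_neg_mul_toReal_conj_le_min {ι : Type*} [Fintype ι] [Nonempty ι]
    {φ : ι → ℝ → EReal} (hφ : ∀ i, IsEntropyFunction (φ i)) {m : ι → ℝ} (hm : ∀ i, 0 < m i)
    {q p : ι → ℕ → ℝ} (hp : ∀ i n, p i n ∈ subdiff (conj (φ i)) (q i n))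
    (hlim : (∀ i, Tendsto (p i) atTop atTop) ∨ (∀ i, Tendsto (p i) atTop (𝓝 0))) :
    ∃ A B C : ℝ, 0 < A ∧ A < B ∧ ∀ i, ∀ q ∈ dom (conj (φ i)),
      -(m i * (conj (φ i) q).toReal) ≤ min (A * -q) (B * -q) + C := by
  classical
  suffices H : ∃ (A B : ℝ) (l b q₁ q₂ : ι → ℝ), 0 < A ∧ A < B ∧ ∀ i, m i * l i ≤ A ∧
      B ≤ m i * b i ∧ l i ∈ subdiff (conj (φ i)) (q₁ i) ∧ b i ∈ subdiff (conj (φ i)) (q₂ i) by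
    obtain ⟨A, B, l, b, q₁, q₂, hA, hAB, h⟩ := H
    refine ⟨A, B, ∑ i, m i * (|(conj (φ i) (q₁ i)).toReal - l i * q₁ i| +
      |(conj (φ i) (q₂ i)).toReal - b i * q₂ i|), hA, hAB, fun i q hq => ?_⟩
    refine (neg_mul_toReal_conj_le_min (hm i).le hAB.le (h i).1 (h i).2.1 (h i).2.2.1
      (h i).2.2.2 hq).trans (add_le_add_right ?_ _)
    exact Finset.single_le_sum (f := fun i => m i * (|(conj (φ i) (q₁ i)).toReal - l i * q₁ i| +
      |(conj (φ i) (q₂ i)).toReal - b i * q₂ i|))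
      (fun k _ => mul_nonneg (hm k).le (by positivity)) (Finset.mem_univ i)
  rcases hlim with h | h
  · have hsum : ∀ i, m i ≤ ∑ k, m k := fun i =>
      Finset.single_le_sum (fun k _ => (hm k).le) (Finset.mem_univ i)
    have hev : ∀ᶠ n in atTop, ∀ i, ∑ k, m k + 1 ≤ m i * p i n :=
      eventually_all.2 fun i => ((h i).const_mul_atTop (hm i)).eventually_ge_atTop _
    obtain ⟨n, hn⟩ := hev.exists
    refine ⟨∑ k, m k, ∑ k, m k + 1, fun _ => 1, fun i => p i n, fun _ => 0, fun i => q i n,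
      Finset.sum_pos (fun k _ => hm k) Finset.univ_nonempty, by linarith, fun i =>
      ⟨by simpa using hsum i, hn i, one_mem_subdiff_conj_zero (hφ i), hp i n⟩⟩
  · obtain ⟨k, hk⟩ := Finite.exists_min m
    have hev : ∀ᶠ n in atTop, ∀ i, m i * p i n < m k / 2 :=
      eventually_all.2 fun i => by
        have := (h i).const_mul (m i)
        rw [mul_zero] at this
        exact this.eventually_lt_const (by have := hm k; positivity)
    obtain ⟨n, hn⟩ := hev.exists
    have := hm k
    exact ⟨m k / 2, m k, fun i => p i n, fun _ => 1, fun i => q i n, fun _ => 0, by positivity,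
      by linarith, fun i => ⟨(hn i).le, by simpa using hk i, hp i n,
        one_mem_subdiff_conj_zero (hφ i)⟩⟩

/-! ### Integration over the product space -/

section Product

variable {N : ℕ} {X : Fin N → Type*}

/-- The density `exp ((f^⊕ - c) / ε)` of the transport plan that belongs to the potentials `f`. -/
def plan (c : (∀ i, X i) → ℝ) (ε : ℝ) (f : ∀ i, X i → ℝ) (x : ∀ i, X i) : ℝ :=
  Real.exp ((∑ i, f i (x i) - c x) / ε)

theorem plan_pos (c : (∀ i, X i) → ℝ) (ε : ℝ) (f : ∀ i, X i → ℝ) (x : ∀ i, X i) :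
    0 < plan c ε f x := Real.exp_pos _

theorem piSplitAt_symm_self (j : Fin N) (z : X j × ∀ i : {i // i ≠ j}, X i) :
    (Equiv.piSplitAt j X).symm z j = z.1 := by
  simp [Equiv.piSplitAt]

theorem piSplitAt_symm_ne (j : Fin N) (z : X j × ∀ i : {i // i ≠ j}, X i) (i : {i // i ≠ j}) :
    (Equiv.piSplitAt j X).symm z i = z.2 i := by
  simp [Equiv.piSplitAt, i.2]

theorem sum_piSplitAt_symm (f : ∀ i, X i → ℝ) (j : Fin N) (z : X j × ∀ i : {i // i ≠ j}, X i) :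
    ∑ i, f i ((Equiv.piSplitAt j X).symm z i) = f j z.1 + ∑ i : {i // i ≠ j}, f i (z.2 i) := by
  rw [Fintype.sum_eq_add_sum_subtype_ne _ j, piSplitAt_symm_self]
  simp only [piSplitAt_symm_ne]

theorem abs_sum_le_of_abs_le {ι : Type*} [Fintype ι] {a : ι → ℝ} {M : ℝ} (h : ∀ i, |a i| ≤ M) :
    |∑ i, a i| ≤ Fintype.card ι * M := by
  refine (Finset.abs_sum_le_sum_abs _ _).trans ((Finset.sum_le_sum fun i _ => h i).trans ?_)
  simp

theorem abs_log_plan_le {c : (∀ i, X i) → ℝ} {C : ℝ} (hC : ∀ x, |c x| ≤ C)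
    {M : ℝ} {f : ∀ i, X i → ℝ} {x : ∀ i, X i}
    (hx : ∀ i, |f i (x i)| ≤ M) : |∑ i, f i (x i) - c x| ≤ N * M + C := by
  have := abs_sum_le_of_abs_le hx
  rw [Fintype.card_fin] at this
  exact (abs_sub _ _).trans (add_le_add this (hC x))

theorem plan_le {c : (∀ i, X i) → ℝ} {C ε : ℝ} (hε : 0 < ε) (hC : ∀ x, |c x| ≤ C)
    {M : ℝ} {f : ∀ i, X i → ℝ} {x : ∀ i, X i}
    (hx : ∀ i, |f i (x i)| ≤ M) : plan c ε f x ≤ Real.exp ((N * M + C) / ε) :=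
  Real.exp_le_exp.2 (div_le_div_of_nonneg_right
    ((le_abs_self _).trans (abs_log_plan_le hC hx)) hε.le)

variable [∀ i, MeasurableSpace (X i)]

/-- Uniform essential boundedness: every coordinate is measurable and bounded by `M`, up to null
sets. -/
def EssBdd (γ : ∀ i, Measure (X i)) (M : ℝ) (f : ∀ i, X i → ℝ) : Prop :=
  ∀ i, AEStronglyMeasurable (f i) (γ i) ∧ ∀ᵐ t ∂γ i, |f i t| ≤ M

theorem EssBdd.mono {γ : ∀ i, Measure (X i)} {M M' : ℝ} {f : ∀ i, X i → ℝ} (hf : EssBdd γ M f)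
    (h : M ≤ M') : EssBdd γ M' f :=
  fun i => ⟨(hf i).1, (hf i).2.mono fun _ ht => ht.trans h⟩

/-- The density of the `j`-th marginal of the plan, without its factor `exp (f j / ε)`. -/
def partitionFn (γ : ∀ i, Measure (X i)) (c : (∀ i, X i) → ℝ) (ε : ℝ) (f : ∀ i, X i → ℝ)
    (j : Fin N) (t : X j) : ℝ :=
  ∫ y : (∀ i : {i // i ≠ j}, X i),
      Real.exp ((∑ i : {i // i ≠ j}, f i (y i) - c ((Equiv.piSplitAt j X).symm (t, y))) / ε)
        ∂(Measure.pi fun i : {i // i ≠ j} => γ i)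

theorem measurable_piSplitAt_symm (j : Fin N) : Measurable (Equiv.piSplitAt j X).symm := by
  refine measurable_pi_lambda _ fun i => ?_
  by_cases h : i = j
  · subst h
    simpa [Equiv.piSplitAt] using measurable_fst
  · simp only [Equiv.piSplitAt, Equiv.coe_fn_symm_mk, h, dite_false]
    exact (measurable_pi_apply (⟨i, h⟩ : {i // i ≠ j})).comp measurable_snd

theorem measurePreserving_piSplitAt_symm (γ : ∀ i, Measure (X i)) [∀ i, IsFiniteMeasure (γ i)]
    (j : Fin N) :
    MeasurePreserving (Equiv.piSplitAt j X).symm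
      ((γ j).prod (Measure.pi fun i : {i // i ≠ j} => γ i)) (Measure.pi γ) := by
  refine ⟨measurable_piSplitAt_symm j, (Measure.pi_eq fun s hs => ?_).symm⟩
  rw [Measure.map_apply (measurable_piSplitAt_symm j) (MeasurableSet.univ_pi hs)]
  have : (Equiv.piSplitAt j X).symm ⁻¹' (Set.univ.pi s) =
      s j ×ˢ Set.univ.pi fun i : {i // i ≠ j} => s i := by
    ext z
    simp only [Set.mem_preimage, Set.mem_univ_pi, Set.mem_prod]
    constructor
    · intro h
      refine ⟨by simpa only [piSplitAt_symm_self] using h j, fun i => ?_⟩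
      simpa only [piSplitAt_symm_ne] using h i
    · rintro ⟨h1, h2⟩ i
      by_cases hi : i = j
      · subst hi; simpa only [piSplitAt_symm_self] using h1
      · have := h2 ⟨i, hi⟩
        rwa [← piSplitAt_symm_ne] at this
  rw [this, Measure.prod_prod, Measure.pi_pi, Fintype.prod_eq_mul_prod_subtype_ne _ j]

variable {γ : ∀ i, Measure (X i)} [∀ i, IsFiniteMeasure (γ i)]

theorem EssBdd.ae_pi {M : ℝ} {f : ∀ i, X i → ℝ} (hf : EssBdd γ M f) :
    ∀ᵐ x ∂Measure.pi γ, ∀ i, |f i (x i)| ≤ M :=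
  ae_all_iff.2 fun i => (Measure.quasiMeasurePreserving_eval γ i).ae (hf i).2

theorem aestronglyMeasurable_comp_eval {i : Fin N} {h : X i → ℝ}
    (hh : AEStronglyMeasurable h (γ i)) :
    AEStronglyMeasurable (fun x : ∀ i, X i => h (x i)) (Measure.pi γ) :=
  hh.comp_quasiMeasurePreserving (Measure.quasiMeasurePreserving_eval γ i)

theorem ae_pi_comp_eval {i : Fin N} {P : X i → Prop} (hh : ∀ᵐ t ∂γ i, P t) :
    ∀ᵐ x ∂Measure.pi γ, P (x i) :=
  (Measure.quasiMeasurePreserving_eval γ i).ae hh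

theorem integrable_of_ae_abs_le {α : Type*} [MeasurableSpace α] {ν : Measure α}
    [IsFiniteMeasure ν] {h : α → ℝ} (hm : AEStronglyMeasurable h ν) {K : ℝ}
    (hK : ∀ᵐ t ∂ν, |h t| ≤ K) : Integrable h ν :=
  Integrable.of_bound hm K (by simpa only [Real.norm_eq_abs] using hK)

variable {c : (∀ i, X i) → ℝ} {C ε : ℝ}

theorem aestronglyMeasurable_plan (hc : Measurable c) {M : ℝ} {f : ∀ i, X i → ℝ}
    (hf : EssBdd γ M f) : AEStronglyMeasurable (plan c ε f) (Measure.pi γ) := by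
  have h1 : AEStronglyMeasurable (fun x : ∀ i, X i => ∑ i, f i (x i)) (Measure.pi γ) :=
    Finset.aestronglyMeasurable_fun_sum _ fun i _ => aestronglyMeasurable_comp_eval (hf i).1
  exact Real.continuous_exp.comp_aestronglyMeasurable
    ((h1.sub hc.aestronglyMeasurable).mul_const ε⁻¹)

theorem integrable_plan (hε : 0 < ε) (hc : Measurable c) (hC : ∀ x, |c x| ≤ C) {M : ℝ}
    {f : ∀ i, X i → ℝ} (hf : EssBdd γ M f) : Integrable (plan c ε f) (Measure.pi γ) := by
  refine integrable_of_ae_abs_le (K := Real.exp ((N * M + C) / ε))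
    (aestronglyMeasurable_plan hc hf) ?_
  filter_upwards [hf.ae_pi] with x hx
  rw [abs_of_pos (plan_pos ..)]
  exact plan_le hε hC hx

theorem integrable_plan_mul (hε : 0 < ε) (hc : Measurable c) (hC : ∀ x, |c x| ≤ C) {M : ℝ}
    {f : ∀ i, X i → ℝ} (hf : EssBdd γ M f) {h : (∀ i, X i) → ℝ}
    (hh : Integrable h (Measure.pi γ)) :
    Integrable (fun x => plan c ε f x * h x) (Measure.pi γ) := by
  refine hh.bdd_mul (c := Real.exp ((N * M + C) / ε)) (aestronglyMeasurable_plan hc hf) ?_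
  filter_upwards [hf.ae_pi] with x hx
  rw [Real.norm_eq_abs, abs_of_pos (plan_pos ..)]
  exact plan_le hε hC hx

/-- The partition function is a convergent integral at every point, not only almost everywhere, as
the cost is bounded everywhere. -/
theorem integrable_partitionFn (hε : 0 < ε) (hc : Measurable c) (hC : ∀ x, |c x| ≤ C) {M : ℝ}
    {f : ∀ i, X i → ℝ} (hf : EssBdd γ M f) (j : Fin N) (t : X j) :
    Integrable (fun y : (∀ i : {i // i ≠ j}, X i) =>
      Real.exp ((∑ i : {i // i ≠ j}, f i (y i) - c ((Equiv.piSplitAt j X).symm (t, y))) / ε))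
      (Measure.pi fun i : {i // i ≠ j} => γ i) := by
  have hm : AEStronglyMeasurable (fun y : (∀ i : {i // i ≠ j}, X i) =>
      ∑ i : {i // i ≠ j}, f i (y i)) (Measure.pi fun i : {i // i ≠ j} => γ i) :=
    Finset.aestronglyMeasurable_fun_sum _ fun i _ => (hf i).1.comp_quasiMeasurePreserving
      (Measure.quasiMeasurePreserving_eval (fun i : {i // i ≠ j} => γ i) i)
  have hc' : Measurable fun y : (∀ i : {i // i ≠ j}, X i) =>
      c ((Equiv.piSplitAt j X).symm (t, y)) :=
    hc.comp ((measurable_piSplitAt_symm j).comp measurable_prodMk_left)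
  have hb : ∀ᵐ y : (∀ i : {i // i ≠ j}, X i) ∂(Measure.pi fun i : {i // i ≠ j} => γ i),
      ∀ i : {i // i ≠ j}, |f i (y i)| ≤ M := ae_all_iff.2 fun i =>
    (Measure.quasiMeasurePreserving_eval (fun i : {i // i ≠ j} => γ i) i).ae (hf i).2
  refine integrable_of_ae_abs_le (K := Real.exp ((Fintype.card {i // i ≠ j} * M + C) / ε))
    (Real.continuous_exp.comp_aestronglyMeasurable
      ((hm.sub hc'.aestronglyMeasurable).mul_const ε⁻¹)) ?_
  filter_upwards [hb] with y hy
  rw [abs_of_pos (Real.exp_pos _), Real.exp_le_exp]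
  refine div_le_div_of_nonneg_right ?_ hε.le
  have h1 := le_abs_self (∑ i : {i // i ≠ j}, f i (y i))
  have h2 := abs_sum_le_of_abs_le hy
  have h3 := neg_abs_le (c ((Equiv.piSplitAt j X).symm (t, y)))
  have h4 := hC ((Equiv.piSplitAt j X).symm (t, y))
  linarith

theorem aestronglyMeasurable_partitionFn (hc : Measurable c) {M : ℝ}
    {f : ∀ i, X i → ℝ} (hf : EssBdd γ M f) (j : Fin N) :
    AEStronglyMeasurable (partitionFn γ c ε f j) (γ j) := by
  have hm : AEStronglyMeasurable (fun z : X j × (∀ i : {i // i ≠ j}, X i) =>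
      ∑ i : {i // i ≠ j}, f i (z.2 i))
      ((γ j).prod (Measure.pi fun i : {i // i ≠ j} => γ i)) := by
    refine Finset.aestronglyMeasurable_fun_sum _ fun i _ => ?_
    exact (hf i).1.comp_quasiMeasurePreserving
      ((Measure.quasiMeasurePreserving_eval (fun i : {i // i ≠ j} => γ i) i).comp
        Measure.quasiMeasurePreserving_snd)
  have hc' : Measurable fun z : X j × (∀ i : {i // i ≠ j}, X i) =>
      c ((Equiv.piSplitAt j X).symm z) := hc.comp (measurable_piSplitAt_symm j)
  exact (Real.continuous_exp.comp_aestronglyMeasurable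
    ((hm.sub hc'.aestronglyMeasurable).mul_const ε⁻¹)).integral_prod_right'

/-- Fubini: integrating a function of the `j`-th coordinate against the plan means integrating it
against the `j`-th marginal. -/
theorem integral_plan_mul_comp_eval (hε : 0 < ε) (hc : Measurable c) (hC : ∀ x, |c x| ≤ C) {M : ℝ}
    {f : ∀ i, X i → ℝ} (hf : EssBdd γ M f) (j : Fin N) {h : X j → ℝ}
    (hh : Integrable (fun x : ∀ i, X i => h (x j)) (Measure.pi γ)) :
    ∫ x, plan c ε f x * h (x j) ∂Measure.pi γ =
      ∫ t, Real.exp (f j t / ε) * partitionFn γ c ε f j t * h t ∂γ j := by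
  have hmp := measurePreserving_piSplitAt_symm γ j
  have hint := integrable_plan_mul hε hc hC hf hh
  rw [← hmp.map_eq, integral_map hmp.measurable.aemeasurable
    (by rw [hmp.map_eq]; exact hint.aestronglyMeasurable)]
  have hint' := hmp.integrable_comp_of_integrable hint
  rw [integral_prod _ (by exact hint')]
  refine integral_congr_ae (ae_of_all _ fun t => ?_)
  simp only [plan, sum_piSplitAt_symm, piSplitAt_symm_self, partitionFn]
  rw [← integral_const_mul, ← integral_mul_const]
  refine integral_congr_ae (ae_of_all _ fun y => ?_)
  simp only
  rw [← Real.exp_add]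
  congr 2; ring

end Product

/-! ### The Sinkhorn mapping -/

section Sinkhorn

set_option linter.unusedSectionVars false

variable {N : ℕ} {X : Fin N → Type*} [∀ i, MeasurableSpace (X i)]

/-- The measure-theoretic content of the assumptions: a measurable cost bounded by `C`, entropy
functions with strictly convex conjugates, and densities `dμ_i/dγ_i` in `[exp (-L), exp L]`. -/
structure Setting (μ γ : ∀ i, Measure (X i)) (φ : Fin N → ℝ → EReal) (c : (∀ i, X i) → ℝ)
    (ε C L : ℝ) : Prop where
  eps_pos : 0 < ε
  measurable_cost : Measurable c
  abs_cost_le : ∀ x, |c x| ≤ C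
  entropy : ∀ i, IsEntropyFunction (φ i)
  strict : ∀ i, IsStrictlyConvex (conj (φ i))
  ac : ∀ i, μ i ≪ γ i
  density_ge : ∀ i, ∀ᵐ t ∂γ i, Real.exp (-L) ≤ ((μ i).rnDeriv (γ i) t).toReal
  density_le : ∀ i, ∀ᵐ t ∂γ i, ((μ i).rnDeriv (γ i) t).toReal ≤ Real.exp L
  ne_zero : ∀ i, μ i ≠ 0

variable {μ γ : ∀ i, Measure (X i)} [∀ i, IsFiniteMeasure (μ i)] [∀ i, IsFiniteMeasure (γ i)]
  {φ : Fin N → ℝ → EReal} {c : (∀ i, X i) → ℝ} {ε C L : ℝ}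

theorem Setting.reference_ne_zero (S : Setting μ γ φ c ε C L) (i : Fin N) : γ i ≠ 0 := fun h => by
  have := S.ac i
  rw [h] at this
  exact S.ne_zero i (Measure.absolutelyContinuous_zero_iff.1 this)

theorem Setting.integral_eq (S : Setting μ γ φ c ε C L) (i : Fin N) (h : X i → ℝ) :
    ∫ t, h t ∂μ i = ∫ t, ((μ i).rnDeriv (γ i) t).toReal * h t ∂γ i := by
  have := integral_rnDeriv_smul (S.ac i) (f := h)
  simpa only [smul_eq_mul] using this.symm

/-- The reference measure is absolutely continuous with respect to the marginal, as the density
is positive. -/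
theorem Setting.reference_ac (S : Setting μ γ φ c ε C L) (i : Fin N) : γ i ≪ μ i := by
  have h : γ i ≪ (γ i).withDensity ((μ i).rnDeriv (γ i)) := by
    refine withDensity_absolutelyContinuous' (Measure.measurable_rnDeriv _ _).aemeasurable ?_
    filter_upwards [S.density_ge i] with t ht h0
    rw [h0, ENNReal.toReal_zero] at ht
    exact absurd ht (not_le.2 (Real.exp_pos _))
  rwa [Measure.withDensity_rnDeriv_eq _ _ (S.ac i)] at h

/-- Up to the factor `exp L`, the reference measure is dominated by the marginal. -/
theorem Setting.integral_reference_le (S : Setting μ γ φ c ε C L) (i : Fin N) {h : X i → ℝ}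
    (h0 : ∀ t, 0 ≤ h t) (hh : Integrable h (μ i)) :
    ∫ t, h t ∂γ i ≤ Real.exp L * ∫ t, h t ∂μ i := by
  rw [S.integral_eq i, ← integral_const_mul]
  rw [← integrable_rnDeriv_smul_iff (S.ac i)] at hh
  refine integral_mono_of_nonneg (ae_of_all _ h0) (hh.const_mul _) ?_
  filter_upwards [S.density_ge i] with t ht
  have : 1 ≤ Real.exp L * ((μ i).rnDeriv (γ i) t).toReal := by
    calc (1 : ℝ) = Real.exp L * Real.exp (-L) := by rw [← Real.exp_add]; simp
      _ ≤ _ := mul_le_mul_of_nonneg_left ht (Real.exp_pos _).le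
  change h t ≤ Real.exp L * (((μ i).rnDeriv (γ i) t).toReal * h t)
  rw [← mul_assoc]
  exact le_mul_of_one_le_left (h0 t) this

theorem Setting.integral_le_reference (S : Setting μ γ φ c ε C L) (i : Fin N) {h : X i → ℝ}
    (h0 : ∀ t, 0 ≤ h t) (hh : Integrable h (γ i)) :
    ∫ t, h t ∂μ i ≤ Real.exp L * ∫ t, h t ∂γ i := by
  rw [S.integral_eq i, ← integral_const_mul]
  refine integral_mono_of_nonneg (ae_of_all _ fun t => mul_nonneg ENNReal.toReal_nonneg (h0 t))
    (hh.const_mul _) ?_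
  filter_upwards [S.density_le i] with t ht
  exact mul_le_mul_of_nonneg_right ht (h0 t)

theorem pi_subtype_ne_zero (S : Setting μ γ φ c ε C L) (j : Fin N) :
    Measure.pi (fun i : {i // i ≠ j} => γ i) ≠ 0 := fun h => by
  have h1 := congrArg (fun ν => ν Set.univ) h
  simp only [Measure.pi_univ, Measure.coe_zero, Pi.zero_apply, Finset.prod_eq_zero_iff] at h1
  obtain ⟨i, -, hi⟩ := h1
  exact S.reference_ne_zero i (Measure.measure_univ_eq_zero.1 hi)

/-- `ε ln ∫ exp (f_j^⊕ / ε) dγ_j^⊗`, to which the `c`-dependent term of the `(c, ε)`-transform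
reduces when the cost vanishes. -/
def logMass (γ : ∀ i, Measure (X i)) (ε : ℝ) (f : ∀ i, X i → ℝ) (j : Fin N) : ℝ :=
  ε * Real.log (∫ y : (∀ i : {i // i ≠ j}, X i), Real.exp ((∑ i : {i // i ≠ j}, f i (y i)) / ε)
    ∂(Measure.pi fun i : {i // i ≠ j} => γ i))

theorem integrable_logMass (hε : 0 < ε) {M : ℝ} {f : ∀ i, X i → ℝ} (hf : EssBdd γ M f)
    {j : Fin N} (t : X j) :
    Integrable (fun y : (∀ i : {i // i ≠ j}, X i) =>
      Real.exp ((∑ i : {i // i ≠ j}, f i (y i)) / ε))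
      (Measure.pi fun i : {i // i ≠ j} => γ i) := by
  have := integrable_partitionFn (c := fun _ => 0) (C := 0) hε measurable_const (by simp) hf j t
  simpa using this

theorem partitionFn_pos (S : Setting μ γ φ c ε C L) {M : ℝ} {f : ∀ i, X i → ℝ}
    (hf : EssBdd γ M f) (j : Fin N) (t : X j) : 0 < partitionFn γ c ε f j t := by
  have : NeZero (Measure.pi fun i : {i // i ≠ j} => γ i) := ⟨pi_subtype_ne_zero S j⟩
  exact integral_exp_pos
    (integrable_partitionFn S.eps_pos S.measurable_cost S.abs_cost_le hf j t)

/-- The cost changes the logarithm of the partition function by at most its own bound. -/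
theorem abs_log_partitionFn_sub_logMass_le (S : Setting μ γ φ c ε C L) {M : ℝ} {f : ∀ i, X i → ℝ}
    (hf : EssBdd γ M f) (j : Fin N) (t : X j) :
    |ε * Real.log (partitionFn γ c ε f j t) - logMass γ ε f j| ≤ C := by
  have hε := S.eps_pos
  have : NeZero (Measure.pi fun i : {i // i ≠ j} => γ i) := ⟨pi_subtype_ne_zero S j⟩
  have hi0 := integrable_logMass hε hf t
  have hi := integrable_partitionFn S.eps_pos S.measurable_cost S.abs_cost_le hf j t
  have hW := integral_exp_pos hi0
  have hZ := partitionFn_pos S hf j t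
  unfold logMass
  set W := ∫ y : (∀ i : {i // i ≠ j}, X i), Real.exp ((∑ i : {i // i ≠ j}, f i (y i)) / ε)
    ∂(Measure.pi fun i : {i // i ≠ j} => γ i)
  have h1 : partitionFn γ c ε f j t ≤ Real.exp (C / ε) * W := by
    rw [← integral_const_mul]
    refine integral_mono hi (hi0.const_mul _) fun y => ?_
    simp only
    rw [← Real.exp_add, Real.exp_le_exp, ← add_div]
    refine div_le_div_of_nonneg_right ?_ hε.le
    have := S.abs_cost_le ((Equiv.piSplitAt j X).symm (t, y))
    linarith [(abs_le.1 this).1]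
  have h2 : Real.exp (-C / ε) * W ≤ partitionFn γ c ε f j t := by
    rw [← integral_const_mul]
    refine integral_mono (hi0.const_mul _) hi fun y => ?_
    simp only
    rw [← Real.exp_add, Real.exp_le_exp, ← add_div]
    refine div_le_div_of_nonneg_right ?_ hε.le
    have := S.abs_cost_le ((Equiv.piSplitAt j X).symm (t, y))
    linarith [(abs_le.1 this).2]
  have h3 := Real.log_le_log hZ h1
  have h4 := Real.log_le_log (by positivity) h2
  rw [Real.log_mul (Real.exp_pos _).ne' hW.ne', Real.log_exp] at h3 h4
  have h5 := mul_le_mul_of_nonneg_left h3 hε.le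
  have h6 := mul_le_mul_of_nonneg_left h4 hε.le
  rw [mul_add, mul_div_cancel₀ _ hε.ne'] at h5 h6
  rw [abs_le]; constructor <;> linarith

theorem abs_logMass_le (S : Setting μ γ φ c ε C L) {M : ℝ} {f : ∀ i, X i → ℝ}
    (hf : EssBdd γ M f) (j : Fin N) (t : X j) :
    |logMass γ ε f j| ≤ Fintype.card {i // i ≠ j} * M +
      ε * |Real.log ((Measure.pi fun i : {i // i ≠ j} => γ i).real Set.univ)| := by
  have hε := S.eps_pos
  have : NeZero (Measure.pi fun i : {i // i ≠ j} => γ i) := ⟨pi_subtype_ne_zero S j⟩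
  have hi0 := integrable_logMass hε hf t
  have hW := integral_exp_pos hi0
  have hb : ∀ᵐ y : (∀ i : {i // i ≠ j}, X i) ∂(Measure.pi fun i : {i // i ≠ j} => γ i),
      ∀ i : {i // i ≠ j}, |f i (y i)| ≤ M := ae_all_iff.2 fun i =>
    (Measure.quasiMeasurePreserving_eval (fun i : {i // i ≠ j} => γ i) i).ae (hf i).2
  unfold logMass
  set ν := Measure.pi fun i : {i // i ≠ j} => γ i
  set n : ℝ := Fintype.card {i // i ≠ j} * M
  set W := ∫ y : (∀ i : {i // i ≠ j}, X i), Real.exp ((∑ i : {i // i ≠ j}, f i (y i)) / ε) ∂ν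
  have hν : 0 < ν.real Set.univ := by
    rw [measureReal_def]
    exact ENNReal.toReal_pos (Measure.measure_univ_ne_zero.2 (NeZero.ne ν)) (measure_ne_top _ _)
  have h1 : W ≤ ν.real Set.univ * Real.exp (n / ε) := by
    have : ∫ _, Real.exp (n / ε) ∂ν = ν.real Set.univ * Real.exp (n / ε) := by simp
    rw [← this]
    refine integral_mono_ae hi0 (integrable_const _) ?_
    filter_upwards [hb] with y hy
    exact Real.exp_le_exp.2 (div_le_div_of_nonneg_right
      ((le_abs_self _).trans (abs_sum_le_of_abs_le hy)) hε.le)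
  have h2 : ν.real Set.univ * Real.exp (-n / ε) ≤ W := by
    have : ∫ _, Real.exp (-n / ε) ∂ν = ν.real Set.univ * Real.exp (-n / ε) := by simp
    rw [← this]
    refine integral_mono_ae (integrable_const _) hi0 ?_
    filter_upwards [hb] with y hy
    exact Real.exp_le_exp.2 (div_le_div_of_nonneg_right
      (neg_le.1 ((neg_le_abs _).trans (abs_sum_le_of_abs_le hy))) hε.le)
  have h3 := Real.log_le_log hW h1
  have h4 := Real.log_le_log (by positivity) h2
  rw [Real.log_mul hν.ne' (Real.exp_pos _).ne', Real.log_exp] at h3 h4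
  have h5 := mul_le_mul_of_nonneg_left h3 hε.le
  have h6 := mul_le_mul_of_nonneg_left h4 hε.le
  rw [mul_add, mul_div_cancel₀ _ hε.ne'] at h5 h6
  have h7 := mul_le_mul_of_nonneg_left (le_abs_self (Real.log (ν.real Set.univ))) hε.le
  have h8 := mul_le_mul_of_nonneg_left (neg_abs_le (Real.log (ν.real Set.univ))) hε.le
  rw [abs_le]; constructor <;> linarith

theorem ceTransform_eq (f : ∀ i, X i → ℝ) (j : Fin N) (t : X j) :
    ceTransform μ γ c ε f j t = ε * Real.log ((μ j).rnDeriv (γ j) t).toReal -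
      ε * Real.log (partitionFn γ c ε f j t) := rfl

/-- The `(c, ε)`-transform has oscillation bounded independently of the potentials. -/
theorem abs_ceTransform_add_logMass_le (S : Setting μ γ φ c ε C L) {M : ℝ} {f : ∀ i, X i → ℝ}
    (hf : EssBdd γ M f) (j : Fin N) :
    ∀ᵐ t ∂γ j, |ceTransform μ γ c ε f j t + logMass γ ε f j| ≤ ε * L + C := by
  filter_upwards [S.density_ge j, S.density_le j] with t h1 h2
  have h0 := (Real.exp_pos (-L)).trans_le h1
  have h3 : |Real.log ((μ j).rnDeriv (γ j) t).toReal| ≤ L :=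
    abs_le.2 ⟨(Real.le_log_iff_exp_le h0).2 h1, (Real.log_le_iff_le_exp h0).2 h2⟩
  have h4 := abs_log_partitionFn_sub_logMass_le S hf j t
  rw [ceTransform_eq]
  obtain ⟨h5, h6⟩ := abs_le.1 h4
  obtain ⟨h7, h8⟩ := abs_le.1 h3
  have h9 := mul_le_mul_of_nonneg_left h7 S.eps_pos.le
  have h10 := mul_le_mul_of_nonneg_left h8 S.eps_pos.le
  rw [abs_le]; constructor <;> linarith

/-- A bound for the `(c, ε)`-transforms of potentials bounded by `M`. -/
def transformBound (γ : ∀ i, Measure (X i)) (ε C L M : ℝ) (j : Fin N) : ℝ :=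
  ε * L + C + (Fintype.card {i // i ≠ j} * M +
      ε * |Real.log ((Measure.pi fun i : {i // i ≠ j} => γ i).real Set.univ)|)

theorem abs_ceTransform_le (S : Setting μ γ φ c ε C L) {M : ℝ} {f : ∀ i, X i → ℝ}
    (hf : EssBdd γ M f) (j : Fin N) :
    ∀ᵐ t ∂γ j, |ceTransform μ γ c ε f j t| ≤ transformBound γ ε C L M j := by
  filter_upwards [abs_ceTransform_add_logMass_le S hf j] with t h1
  have h2 := abs_logMass_le S hf j t
  unfold transformBound
  rw [abs_le] at h1 h2 ⊢
  constructor <;> linarith [h1.1, h1.2, h2.1, h2.2]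

theorem aestronglyMeasurable_ceTransform (S : Setting μ γ φ c ε C L) {M : ℝ} {f : ∀ i, X i → ℝ}
    (hf : EssBdd γ M f) (j : Fin N) :
    AEStronglyMeasurable (ceTransform μ γ c ε f j) (γ j) := by
  have h1 : Measurable fun t => ε * Real.log ((μ j).rnDeriv (γ j) t).toReal :=
    ((Measure.measurable_rnDeriv _ _).ennreal_toReal.log).const_mul ε
  have h2 := (aestronglyMeasurable_partitionFn (ε := ε) S.measurable_cost hf j).aemeasurable
  exact h1.aestronglyMeasurable.sub ((h2.log.const_mul ε).aestronglyMeasurable)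

theorem aestronglyMeasurable_sinkhornMap (S : Setting μ γ φ c ε C L) {M : ℝ} {f : ∀ i, X i → ℝ}
    (hf : EssBdd γ M f) (j : Fin N) :
    AEStronglyMeasurable (sinkhornMap μ γ φ c ε f j) (γ j) :=
  ((continuous_aprox (S.entropy j) (S.strict j) S.eps_pos).comp_aestronglyMeasurable
    (aestronglyMeasurable_ceTransform S hf j).neg).neg

/-- The Sinkhorn mapping produces functions of bounded oscillation. -/
theorem exists_abs_sinkhornMap_sub_le (S : Setting μ γ φ c ε C L) {M : ℝ} {f : ∀ i, X i → ℝ}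
    (hf : EssBdd γ M f) (j : Fin N) :
    ∃ a : ℝ, ∀ᵐ t ∂γ j, |sinkhornMap μ γ φ c ε f j t - a| ≤ ε * L + C := by
  refine ⟨-aprox (conj (φ j)) ε (logMass γ ε f j), ?_⟩
  filter_upwards [abs_ceTransform_add_logMass_le S hf j] with t ht
  refine le_trans ?_ ht
  have := abs_aprox_sub_aprox_le (S.entropy j) (S.strict j) S.eps_pos (logMass γ ε f j)
    (-ceTransform μ γ c ε f j t)
  unfold sinkhornMap
  rw [neg_sub_neg]
  simpa [add_comm] using this

/-- A bound for the images under the Sinkhorn mapping of potentials bounded by `M`. -/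
def sinkhornBound (γ : ∀ i, Measure (X i)) (φ : Fin N → ℝ → EReal) (ε C L M : ℝ) (j : Fin N) : ℝ :=
  transformBound γ ε C L M j + |aprox (conj (φ j)) ε 0|

theorem abs_sinkhornMap_le (S : Setting μ γ φ c ε C L) {M : ℝ} {f : ∀ i, X i → ℝ}
    (hf : EssBdd γ M f) (j : Fin N) :
    ∀ᵐ t ∂γ j, |sinkhornMap μ γ φ c ε f j t| ≤ sinkhornBound γ φ ε C L M j := by
  filter_upwards [abs_ceTransform_le S hf j] with t ht
  have h1 := abs_aprox_sub_aprox_le (S.entropy j) (S.strict j) S.eps_pos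
    (-ceTransform μ γ c ε f j t) 0
  rw [sub_zero, abs_neg] at h1
  have h2 := abs_sub_abs_le_abs_sub (aprox (conj (φ j)) ε (-ceTransform μ γ c ε f j t))
    (aprox (conj (φ j)) ε 0)
  unfold sinkhornBound sinkhornMap
  rw [abs_neg]
  linarith

/-- The subgradient of `φ_j^*` at `-f_j` that the optimality of the Sinkhorn mapping provides. -/
def sinkhornSlope (μ γ : ∀ i, Measure (X i)) (φ : Fin N → ℝ → EReal) (c : (∀ i, X i) → ℝ)
    (ε : ℝ) (f : ∀ i, X i → ℝ) (j : Fin N) (t : X j) : ℝ :=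
  Real.exp ((sinkhornMap μ γ φ c ε f j t - ceTransform μ γ c ε f j t) / ε)

theorem neg_sinkhornMap_mem_dom (S : Setting μ γ φ c ε C L) (f : ∀ i, X i → ℝ) (j : Fin N)
    (t : X j) : -sinkhornMap μ γ φ c ε f j t ∈ dom (conj (φ j)) := by
  unfold sinkhornMap
  rw [neg_neg]
  exact aprox_mem_dom (S.entropy j) S.eps_pos _

theorem sinkhornSlope_subgradient (S : Setting μ γ φ c ε C L) (f : ∀ i, X i → ℝ) (j : Fin N)
    (t : X j) {s : ℝ} (hs : -s ∈ dom (conj (φ j))) :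
    (conj (φ j) (-sinkhornMap μ γ φ c ε f j t)).toReal -
        sinkhornSlope μ γ φ c ε f j t * (s - sinkhornMap μ γ φ c ε f j t) ≤
      (conj (φ j) (-s)).toReal := by
  have := aprox_subgradient (S.entropy j) (S.strict j) S.eps_pos (-ceTransform μ γ c ε f j t) hs
  have h1 : aprox (conj (φ j)) ε (-ceTransform μ γ c ε f j t) = -sinkhornMap μ γ φ c ε f j t := by
    unfold sinkhornMap; rw [neg_neg]
  rw [h1, show (-ceTransform μ γ c ε f j t - -sinkhornMap μ γ φ c ε f j t) =
    sinkhornMap μ γ φ c ε f j t - ceTransform μ γ c ε f j t by ring] at this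
  unfold sinkhornSlope
  linarith

theorem sinkhornSlope_le (S : Setting μ γ φ c ε C L) {M : ℝ} {f : ∀ i, X i → ℝ}
    (hf : EssBdd γ M f) (j : Fin N) : ∀ᵐ t ∂γ j, sinkhornSlope μ γ φ c ε f j t ≤
      Real.exp ((sinkhornBound γ φ ε C L M j + transformBound γ ε C L M j) / ε) := by
  filter_upwards [abs_ceTransform_le S hf j, abs_sinkhornMap_le S hf j] with t h1 h2
  refine Real.exp_le_exp.2 (div_le_div_of_nonneg_right ?_ S.eps_pos.le)
  linarith [(abs_le.1 h1).1, (abs_le.1 h2).2]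

/-- The subgradients, weighted with the density of `μ_j`, form the `j`-th marginal of the plan. -/
theorem density_mul_sinkhornSlope (S : Setting μ γ φ c ε C L) {M : ℝ} {f : ∀ i, X i → ℝ}
    (hf : EssBdd γ M f) (j : Fin N) : ∀ᵐ t ∂γ j,
      ((μ j).rnDeriv (γ j) t).toReal * sinkhornSlope μ γ φ c ε f j t =
        Real.exp (sinkhornMap μ γ φ c ε f j t / ε) * partitionFn γ c ε f j t := by
  filter_upwards [S.density_ge j] with t h1
  have h0 := (Real.exp_pos (-L)).trans_le h1
  have hZ := partitionFn_pos S hf j t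
  have hε := S.eps_pos.ne'
  unfold sinkhornSlope
  rw [ceTransform_eq, ← mul_sub, sub_div, mul_div_cancel_left₀ _ hε, Real.exp_sub, Real.exp_sub,
    Real.exp_log h0, Real.exp_log hZ]
  field_simp

theorem partitionFn_update (f : ∀ i, X i → ℝ) (j : Fin N) (g : X j → ℝ) (t : X j) :
    partitionFn γ c ε (Function.update f j g) j t = partitionFn γ c ε f j t := by
  unfold partitionFn
  refine integral_congr_ae (ae_of_all _ fun y => ?_)
  have : ∑ i : {i // i ≠ j}, Function.update f j g i (y i) = ∑ i : {i // i ≠ j}, f i (y i) :=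
    Finset.sum_congr rfl fun i _ => by rw [Function.update_of_ne i.2]
  simp only [this]

end Sinkhorn

/-! ### The dual functional on admissible potentials -/

section Dual

set_option linter.unusedSectionVars false

variable {N : ℕ} {X : Fin N → Type*} [∀ i, MeasurableSpace (X i)]

/-- The real-valued penalty `s ↦ φ^*(-s)`, meaningful for `-s ∈ dom φ^*`. -/
def penalty (φ : ℝ → EReal) (s : ℝ) : ℝ := (conj φ (-s)).toReal

/-- Potentials bounded by `M` at which the dual functional is finite. -/
def Admissible (μ γ : ∀ i, Measure (X i)) (φ : Fin N → ℝ → EReal) (M : ℝ)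
    (f : ∀ i, X i → ℝ) : Prop :=
  EssBdd γ M f ∧ ∀ i, (∀ᵐ t ∂γ i, -f i t ∈ dom (conj (φ i))) ∧
    Integrable (fun t => penalty (φ i) (f i t)) (μ i)

/-- The dual functional as a real number, meaningful for admissible potentials. -/
def realDual (μ γ : ∀ i, Measure (X i)) (φ : Fin N → ℝ → EReal) (c : (∀ i, X i) → ℝ)
    (ε : ℝ) (f : ∀ i, X i → ℝ) : ℝ :=
  -(∑ i, ∫ t, penalty (φ i) (f i t) ∂μ i) - ε * ∫ x, (plan c ε f x - 1) ∂Measure.pi γ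

theorem measurable_conj {φ : ℝ → EReal} (hφ : IsEntropyFunction φ) : Measurable (conj φ) :=
  (lowerSemicontinuous_conj hφ).measurable

theorem measurable_penalty {φ : ℝ → EReal} (hφ : IsEntropyFunction φ) : Measurable (penalty φ) :=
  ((measurable_conj hφ).comp measurable_neg).ereal_toReal

theorem neg_le_penalty {φ : ℝ → EReal} (hφ : IsEntropyFunction φ) {s : ℝ}
    (hs : -s ∈ dom (conj φ)) : -s ≤ penalty φ s := le_toReal_conj hφ hs

/-- Strong convexity of `exp`: its Bregman divergence dominates the squared difference of the
square roots. -/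
theorem sq_exp_half_sub_le {ε : ℝ} (hε : 0 < ε) (A B : ℝ) :
    ε * (Real.exp (A / (2 * ε)) - Real.exp (B / (2 * ε))) ^ 2 ≤
      ε * (Real.exp (A / ε) - Real.exp (B / ε)) - Real.exp (B / ε) * (A - B) := by
  have hA : Real.exp (A / ε) = Real.exp (A / (2 * ε)) ^ 2 := by
    rw [← Real.exp_nat_mul]; congr 1; push_cast; field_simp
  have hB : Real.exp (B / ε) = Real.exp (B / (2 * ε)) ^ 2 := by
    rw [← Real.exp_nat_mul]; congr 1; push_cast; field_simp
  have h1 := Real.add_one_le_exp ((A - B) / (2 * ε))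
  have h2 : Real.exp (A / (2 * ε)) = Real.exp (B / (2 * ε)) * Real.exp ((A - B) / (2 * ε)) := by
    rw [← Real.exp_add]; congr 1; ring
  rw [hA, hB]
  have hb := Real.exp_pos (B / (2 * ε))
  set a := Real.exp (A / (2 * ε))
  set b := Real.exp (B / (2 * ε))
  have h3 : b * ((A - B) / (2 * ε) + 1) ≤ a := h2 ▸ mul_le_mul_of_nonneg_left h1 hb.le
  have h4 : 2 * ε * b * (b * ((A - B) / (2 * ε) + 1)) ≤ 2 * ε * b * a :=
    mul_le_mul_of_nonneg_left h3 (by positivity)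
  have h5 : 2 * ε * b * (b * ((A - B) / (2 * ε) + 1)) = b ^ 2 * (A - B) + 2 * ε * b ^ 2 := by
    field_simp
  nlinarith

variable {μ γ : ∀ i, Measure (X i)} [∀ i, IsFiniteMeasure (μ i)] [∀ i, IsFiniteMeasure (γ i)]
  {φ : Fin N → ℝ → EReal} {c : (∀ i, X i) → ℝ} {ε C L : ℝ}

theorem Admissible.mono {M M' : ℝ} {f : ∀ i, X i → ℝ} (hf : Admissible μ γ φ M f)
    (h : M ≤ M') : Admissible μ γ φ M' f := ⟨hf.1.mono h, hf.2⟩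

theorem aestronglyMeasurable_penalty (S : Setting μ γ φ c ε C L) {i : Fin N} {h : X i → ℝ}
    (hh : AEStronglyMeasurable h (γ i)) :
    AEStronglyMeasurable (fun t => penalty (φ i) (h t)) (μ i) :=
  ((measurable_penalty (S.entropy i)).comp_aemeasurable
    (hh.mono_ac (S.ac i)).aemeasurable).aestronglyMeasurable

theorem integrable_comp_eval {i : Fin N} {h : X i → ℝ}
    (hh : Integrable h (γ i)) :
    Integrable (fun x : ∀ i, X i => h (x i)) (Measure.pi γ) := by
  have : Integrable h ((Measure.pi γ).map (Function.eval i)) := by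
    rw [Measure.pi_map_eval]
    exact hh.smul_measure (by simp [ENNReal.prod_ne_top])
  exact this.comp_measurable (measurable_pi_apply i)

theorem EssBdd.integrable {M : ℝ} {f : ∀ i, X i → ℝ} (hf : EssBdd γ M f) (i : Fin N) :
    Integrable (f i) (γ i) := integrable_of_ae_abs_le (hf i).1 (hf i).2

theorem EssBdd.integrable_marginal (S : Setting μ γ φ c ε C L) {M : ℝ} {f : ∀ i, X i → ℝ}
    (hf : EssBdd γ M f) (i : Fin N) :
    Integrable (f i) (μ i) :=
  integrable_of_ae_abs_le ((hf i).1.mono_ac (S.ac i)) ((S.ac i).ae_le (hf i).2)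

/-- Penalties of Sinkhorn images are essentially bounded: from below by `q ≤ φ^* q`, from above by
the subgradient inequality at `0 ∈ dom φ^*`. -/
theorem ae_abs_sinkhornMap_penalty_le (S : Setting μ γ φ c ε C L) {M : ℝ} {f : ∀ i, X i → ℝ}
    (hf : EssBdd γ M f) (j : Fin N) :
    ∃ K, ∀ᵐ t ∂γ j, |penalty (φ j) (sinkhornMap μ γ φ c ε f j t)| ≤ K := by
  refine ⟨sinkhornBound γ φ ε C L M j +
    Real.exp ((sinkhornBound γ φ ε C L M j + transformBound γ ε C L M j) / ε) *
      sinkhornBound γ φ ε C L M j, ?_⟩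
  filter_upwards [abs_sinkhornMap_le S hf j, sinkhornSlope_le S hf j] with t h1 h2
  have h3 := neg_le_penalty (S.entropy j) (neg_sinkhornMap_mem_dom S f j t)
  have h4 := sinkhornSlope_subgradient S f j t (s := 0)
    (by rw [neg_zero]; exact zero_mem_dom_conj (S.entropy j))
  rw [neg_zero, conj_zero (S.entropy j)] at h4
  change penalty (φ j) _ - _ ≤ _ at h4
  have h5 : sinkhornSlope μ γ φ c ε f j t * (0 - sinkhornMap μ γ φ c ε f j t) ≤
      Real.exp ((sinkhornBound γ φ ε C L M j + transformBound γ ε C L M j) / ε) *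
      sinkhornBound γ φ ε C L M j := by
    have hs : 0 ≤ sinkhornSlope μ γ φ c ε f j t := (Real.exp_pos _).le
    calc _ ≤ sinkhornSlope μ γ φ c ε f j t * |sinkhornMap μ γ φ c ε f j t| :=
          mul_le_mul_of_nonneg_left (by linarith [neg_le_abs (sinkhornMap μ γ φ c ε f j t)]) hs
      _ ≤ _ := mul_le_mul h2 h1 (abs_nonneg _) (Real.exp_pos _).le
  have h6 := (abs_nonneg _).trans h1
  have h7 : 0 ≤ Real.exp ((sinkhornBound γ φ ε C L M j + transformBound γ ε C L M j) / ε) *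
      sinkhornBound γ φ ε C L M j := mul_nonneg (Real.exp_pos _).le h6
  simp only [EReal.toReal_zero] at h4
  rw [abs_le]
  constructor <;> linarith [(abs_le.1 h1).2]

theorem integrable_penalty_sinkhornMap (S : Setting μ γ φ c ε C L) {M : ℝ} {f : ∀ i, X i → ℝ}
    (hf : EssBdd γ M f) (j : Fin N) :
    Integrable (fun t => penalty (φ j) (sinkhornMap μ γ φ c ε f j t)) (μ j) := by
  obtain ⟨K, hK⟩ := ae_abs_sinkhornMap_penalty_le S hf j
  exact integrable_of_ae_abs_le
    (aestronglyMeasurable_penalty S (aestronglyMeasurable_sinkhornMap S hf j))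
    ((S.ac j).ae_le hK)

/-- One Sinkhorn step: the potentials with the `j`-th one replaced by its Sinkhorn mapping. -/
def sinkhornStep (μ γ : ∀ i, Measure (X i)) (φ : Fin N → ℝ → EReal) (c : (∀ i, X i) → ℝ)
    (ε : ℝ) (f : ∀ i, X i → ℝ) (j : Fin N) : ∀ i, X i → ℝ :=
  Function.update f j (sinkhornMap μ γ φ c ε f j)

theorem essBdd_sinkhornStep (S : Setting μ γ φ c ε C L) {M : ℝ} {f : ∀ i, X i → ℝ}
    (hf : EssBdd γ M f) (j : Fin N) :
    EssBdd γ (max M (sinkhornBound γ φ ε C L M j)) (sinkhornStep μ γ φ c ε f j) := by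
  intro i
  unfold sinkhornStep
  by_cases h : i = j
  · subst h
    rw [Function.update_self]
    exact ⟨aestronglyMeasurable_sinkhornMap S hf i,
      (abs_sinkhornMap_le S hf i).mono fun t ht => ht.trans (le_max_right _ _)⟩
  · rw [Function.update_of_ne h]
    exact ⟨(hf i).1, (hf i).2.mono fun t ht => ht.trans (le_max_left _ _)⟩

/-- The variational inequality that characterizes the updated coordinate: `f_j` minimizes the
`j`-th penalty plus a linear functional, namely integration against the plan. -/
theorem integral_penalty_sinkhornStep_le (S : Setting μ γ φ c ε C L) {M : ℝ} {f : ∀ i, X i → ℝ}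
    (hf : EssBdd γ M f) (j : Fin N) {g : X j → ℝ} (hg : Integrable g (γ j))
    (hg' : Integrable g (μ j)) (hdom : ∀ᵐ t ∂γ j, -g t ∈ dom (conj (φ j)))
    (hint : Integrable (fun t => penalty (φ j) (g t)) (μ j)) :
    ∫ t, penalty (φ j) (sinkhornStep μ γ φ c ε f j j t) ∂μ j -
      ∫ x, plan c ε (sinkhornStep μ γ φ c ε f j) x * (g (x j) - sinkhornStep μ γ φ c ε f j j (x j))
        ∂Measure.pi γ ≤ ∫ t, penalty (φ j) (g t) ∂μ j := by
  have hb := essBdd_sinkhornStep S hf j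
  have hj : sinkhornStep μ γ φ c ε f j j = sinkhornMap μ γ φ c ε f j := Function.update_self ..
  have hi1 := hb.integrable j
  have hi2 := hb.integrable_marginal S j
  have hpi := integrable_comp_eval (hg.sub hi1)
  simp only [Pi.sub_apply] at hpi
  rw [integral_plan_mul_comp_eval S.eps_pos S.measurable_cost S.abs_cost_le hb j
    (h := fun t => g t - sinkhornStep μ γ φ c ε f j j t) hpi]
  rw [hj] at hi1 hi2 ⊢
  have hpart : ∀ t, partitionFn γ c ε (sinkhornStep μ γ φ c ε f j) j t = partitionFn γ c ε f j t :=
    fun t => partitionFn_update f j _ t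
  simp only [hpart]
  have hslope : AEStronglyMeasurable (sinkhornSlope μ γ φ c ε f j) (γ j) :=
    Real.continuous_exp.comp_aestronglyMeasurable (((aestronglyMeasurable_sinkhornMap S hf j).sub
      (aestronglyMeasurable_ceTransform S hf j)).mul_const ε⁻¹)
  have hlin : Integrable (fun t => sinkhornSlope μ γ φ c ε f j t *
      (g t - sinkhornMap μ γ φ c ε f j t)) (μ j) := by
    refine (hg'.sub hi2).bdd_mul
      (c := Real.exp ((sinkhornBound γ φ ε C L M j + transformBound γ ε C L M j) / ε))
      (hslope.mono_ac (S.ac j)) ?_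
    filter_upwards [(S.ac j).ae_le (sinkhornSlope_le S hf j)] with t ht
    rwa [Real.norm_of_nonneg (show 0 ≤ sinkhornSlope μ γ φ c ε f j t from (Real.exp_pos _).le)]
  have heq : ∫ t, Real.exp (sinkhornMap μ γ φ c ε f j t / ε) * partitionFn γ c ε f j t *
      (g t - sinkhornMap μ γ φ c ε f j t) ∂γ j =
      ∫ t, sinkhornSlope μ γ φ c ε f j t * (g t - sinkhornMap μ γ φ c ε f j t) ∂μ j := by
    rw [S.integral_eq j]
    refine integral_congr_ae ?_
    filter_upwards [density_mul_sinkhornSlope S hf j] with t ht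
    rw [← ht, mul_assoc]
  have hip := integrable_penalty_sinkhornMap S hf j
  rw [heq, ← integral_sub hip hlin]
  refine integral_mono_ae (hip.sub hlin) hint ?_
  filter_upwards [(S.ac j).ae_le hdom] with t ht
  exact sinkhornSlope_subgradient S f j t ht

theorem sum_comp_update (F : ∀ i, (X i → ℝ) → ℝ) (f : ∀ i, X i → ℝ) (j : Fin N) (g : X j → ℝ) :
    ∑ i, F i (Function.update f j g i) = ∑ i, F i (f i) + (F j g - F j (f j)) := by
  rw [Fintype.sum_eq_add_sum_subtype_ne _ j, Fintype.sum_eq_add_sum_subtype_ne _ j,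
    Function.update_self]
  have : ∑ i : {i // i ≠ j}, F i (Function.update f j g i) = ∑ i : {i // i ≠ j}, F i (f i) :=
    Finset.sum_congr rfl fun i _ => by rw [Function.update_of_ne i.2]
  rw [this]; ring

theorem realDual_eq (S : Setting μ γ φ c ε C L) {M : ℝ} {f : ∀ i, X i → ℝ}
    (hf : EssBdd γ M f) : realDual μ γ φ c ε f =
      -(∑ i, ∫ t, penalty (φ i) (f i t) ∂μ i) - ε * ∫ x, plan c ε f x ∂Measure.pi γ +
        ε * (Measure.pi γ).real Set.univ := by
  unfold realDual
  rw [integral_sub (integrable_plan S.eps_pos S.measurable_cost S.abs_cost_le hf)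
    (integrable_const _)]
  simp only [integral_const, smul_eq_mul, mul_one]
  ring

/-- A Sinkhorn step increases the dual functional by at least a Hellinger distance of the plans;
the square root of a plan for `ε` is the plan for `2 ε`. -/
theorem realDual_add_sq_le_sinkhornStep (S : Setting μ γ φ c ε C L) {M : ℝ} {f : ∀ i, X i → ℝ}
    (hf : Admissible μ γ φ M f) (j : Fin N) :
    realDual μ γ φ c ε f + ε * ∫ x, (plan c (2 * ε) f x -
        plan c (2 * ε) (sinkhornStep μ γ φ c ε f j) x) ^ 2 ∂Measure.pi γ ≤
      realDual μ γ φ c ε (sinkhornStep μ γ φ c ε f j) := by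
  have hb := essBdd_sinkhornStep S hf.1 j
  have hv := integral_penalty_sinkhornStep_le S hf.1 j (hf.1.integrable j)
    (hf.1.integrable_marginal S j) (hf.2 j).1 (hf.2 j).2
  have hs := sum_comp_update (fun i h => ∫ t, penalty (φ i) (h t) ∂μ i) f j
    (sinkhornMap μ γ φ c ε f j)
  rw [realDual_eq S hf.1, realDual_eq S hb]
  have hj : sinkhornStep μ γ φ c ε f j j = sinkhornMap μ γ φ c ε f j := Function.update_self ..
  change ∑ i, ∫ t, penalty (φ i) (sinkhornStep μ γ φ c ε f j i t) ∂μ i = _ at hs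
  rw [hs, ← hj]
  have hp1 := integrable_plan S.eps_pos S.measurable_cost S.abs_cost_le hf.1
  have hp2 := integrable_plan S.eps_pos S.measurable_cost S.abs_cost_le hb
  have hlin := integrable_plan_mul S.eps_pos S.measurable_cost S.abs_cost_le hb
    (integrable_comp_eval ((hf.1.integrable j).sub (hb.integrable j)))
  simp only [Pi.sub_apply] at hlin
  have hmain : ε * ∫ x, (plan c (2 * ε) f x -
        plan c (2 * ε) (sinkhornStep μ γ φ c ε f j) x) ^ 2 ∂Measure.pi γ ≤
      ε * (∫ x, plan c ε f x ∂Measure.pi γ -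
        ∫ x, plan c ε (sinkhornStep μ γ φ c ε f j) x ∂Measure.pi γ) -
      ∫ x, plan c ε (sinkhornStep μ γ φ c ε f j) x *
        (f j (x j) - sinkhornStep μ γ φ c ε f j j (x j)) ∂Measure.pi γ := by
    have hd : Integrable (fun x => ε * (plan c ε f x -
      plan c ε (sinkhornStep μ γ φ c ε f j) x)) (Measure.pi γ) := (hp1.sub hp2).const_mul ε
    rw [← integral_sub hp1 hp2, ← integral_const_mul, ← integral_const_mul, ← integral_sub hd hlin]
    refine integral_mono_of_nonneg
      (ae_of_all _ fun x => mul_nonneg S.eps_pos.le (sq_nonneg _))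
      (hd.sub hlin) (ae_of_all _ fun x => ?_)
    have h1 := sq_exp_half_sub_le S.eps_pos (∑ i, f i (x i) - c x)
      (∑ i, sinkhornStep μ γ φ c ε f j i (x i) - c x)
    have h2 := sum_comp_update (fun i h => h (x i)) f j (sinkhornMap μ γ φ c ε f j)
    change ∑ i, sinkhornStep μ γ φ c ε f j i (x i) = _ at h2
    rw [show ∑ i, f i (x i) - c x - (∑ i, sinkhornStep μ γ φ c ε f j i (x i) - c x) =
      f j (x j) - sinkhornStep μ γ φ c ε f j j (x j) by rw [h2, hj]; ring] at h1
    exact h1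
  linarith

/-- If every coordinate of `f` was produced by a Sinkhorn step whose plan is close in `L¹` to that
of `f`, then `f` is nearly optimal. -/
theorem realDual_le_add_of_sinkhornStep (S : Setting μ γ φ c ε C L) {M G : ℝ}
    {f g : ∀ i, X i → ℝ} (hf : Admissible μ γ φ M f) (hg : Admissible μ γ φ G g)
    {h : Fin N → ∀ i, X i → ℝ} (hh : ∀ j, EssBdd γ M (h j))
    (hstep : ∀ j, sinkhornStep μ γ φ c ε (h j) j j = f j) :
    realDual μ γ φ c ε g ≤ realDual μ γ φ c ε f + (G + M) * ∑ j, ∫ x,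
      |plan c ε (sinkhornStep μ γ φ c ε (h j) j) x - plan c ε f x| ∂Measure.pi γ := by
  have hε := S.eps_pos
  have hpf := integrable_plan hε S.measurable_cost S.abs_cost_le hf.1
  have hpg := integrable_plan hε S.measurable_cost S.abs_cost_le hg.1
  have hbj := fun j => essBdd_sinkhornStep S (hh j) j
  have hpj := fun j => integrable_plan hε S.measurable_cost S.abs_cost_le (hbj j)
  have hdiff : ∀ j, Integrable (fun x : ∀ i, X i => g j (x j) - f j (x j)) (Measure.pi γ) :=
    fun j => integrable_comp_eval ((hg.1.integrable j).sub (hf.1.integrable j))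
  have hlf := fun j => integrable_plan_mul hε S.measurable_cost S.abs_cost_le hf.1 (hdiff j)
  have hlj := fun j => integrable_plan_mul hε S.measurable_cost S.abs_cost_le (hbj j) (hdiff j)
  have hv : ∀ j, ∫ t, penalty (φ j) (f j t) ∂μ j - ∫ t, penalty (φ j) (g j t) ∂μ j ≤
      ∫ x, plan c ε (sinkhornStep μ γ φ c ε (h j) j) x * (g j (x j) - f j (x j))
        ∂Measure.pi γ := fun j => by
    have := integral_penalty_sinkhornStep_le S (hh j) j (hg.1.integrable j)
      (hg.1.integrable_marginal S j) (hg.2 j).1 (hg.2 j).2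
    rw [hstep j] at this
    linarith
  have hexp : ∑ j, ∫ x, plan c ε f x * (g j (x j) - f j (x j)) ∂Measure.pi γ ≤
      ε * ∫ x, plan c ε g x ∂Measure.pi γ - ε * ∫ x, plan c ε f x ∂Measure.pi γ := by
    rw [← integral_finsetSum _ fun j _ => hlf j, ← integral_const_mul, ← integral_const_mul,
      ← integral_sub (hpg.const_mul ε) (hpf.const_mul ε)]
    refine integral_mono (integrable_finsetSum _ fun j _ => hlf j)
      ((hpg.const_mul ε).sub (hpf.const_mul ε)) fun x => ?_
    have h1 := sq_exp_half_sub_le hε (∑ i, g i (x i) - c x) (∑ i, f i (x i) - c x)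
    have h2 := mul_nonneg hε.le (sq_nonneg (Real.exp ((∑ i, g i (x i) - c x) / (2 * ε)) -
      Real.exp ((∑ i, f i (x i) - c x) / (2 * ε))))
    simp only [plan]
    rw [← Finset.mul_sum, Finset.sum_sub_distrib]
    rw [sub_sub_sub_cancel_right] at h1
    linarith
  have herr : ∀ j, ∫ x, plan c ε (sinkhornStep μ γ φ c ε (h j) j) x * (g j (x j) - f j (x j))
        ∂Measure.pi γ - ∫ x, plan c ε f x * (g j (x j) - f j (x j)) ∂Measure.pi γ ≤
      (G + M) * ∫ x, |plan c ε (sinkhornStep μ γ φ c ε (h j) j) x - plan c ε f x|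
        ∂Measure.pi γ := fun j => by
    rw [← integral_sub (hlj j) (hlf j), ← integral_const_mul]
    refine integral_mono_ae ((hlj j).sub (hlf j)) (((hpj j).sub hpf).abs.const_mul _) ?_
    filter_upwards [hf.1.ae_pi, hg.1.ae_pi] with x h1 h2
    rw [← sub_mul]
    have h3 : |g j (x j) - f j (x j)| ≤ G + M :=
      (abs_sub _ _).trans (add_le_add (h2 j) (h1 j))
    refine (le_abs_self _).trans ?_
    rw [abs_mul, mul_comm]
    exact mul_le_mul_of_nonneg_right h3 (abs_nonneg _)
  have hsum := Finset.sum_le_sum fun j (_ : j ∈ Finset.univ) => hv j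
  have hsum2 := Finset.sum_le_sum fun j (_ : j ∈ Finset.univ) => herr j
  rw [Finset.sum_sub_distrib] at hsum hsum2
  rw [← Finset.mul_sum] at hsum2
  rw [realDual_eq S hf.1, realDual_eq S hg.1]
  linarith

theorem Admissible.midpoint (S : Setting μ γ φ c ε C L) {M : ℝ} {f g : ∀ i, X i → ℝ}
    (hf : Admissible μ γ φ M f) (hg : Admissible μ γ φ M g) :
    Admissible μ γ φ M (fun i t => (f i t + g i t) / 2) := by
  have hbdd : EssBdd γ M (fun i t => (f i t + g i t) / 2) := fun i =>
    ⟨((hf.1 i).1.add (hg.1 i).1).mul_const 2⁻¹, by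
      filter_upwards [(hf.1 i).2, (hg.1 i).2] with t h1 h2
      rw [abs_le] at h1 h2 ⊢
      constructor <;> linarith [h1.1, h1.2, h2.1, h2.2]⟩
  have hdom : ∀ i, ∀ᵐ t ∂γ i, -((f i t + g i t) / 2) ∈ dom (conj (φ i)) := fun i => by
    filter_upwards [(hf.2 i).1, (hg.2 i).1] with t h1 h2
    have := midpoint_mem_of_convex (S.strict i).1 h1 h2
    rwa [show (-f i t + -g i t) / 2 = -((f i t + g i t) / 2) by ring] at this
  refine ⟨hbdd, fun i => ⟨hdom i, ?_⟩⟩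
  refine Integrable.mono' (((hf.2 i).2.abs.add (hg.2 i).2.abs).add (integrable_const M))
    (aestronglyMeasurable_penalty S (hbdd i).1) ?_
  filter_upwards [(S.ac i).ae_le (hf.2 i).1, (S.ac i).ae_le (hg.2 i).1, (S.ac i).ae_le (hdom i),
    (S.ac i).ae_le (hbdd i).2] with t h1 h2 h3 h4
  have h5 := neg_le_penalty (S.entropy i) h3
  have h6 := midGap_nonneg (S.strict i).convexOn h1 h2
  unfold midGap at h6
  rw [show (-f i t + -g i t) / 2 = -((f i t + g i t) / 2) by ring] at h6
  change 0 ≤ penalty (φ i) (f i t) / 2 + penalty (φ i) (g i t) / 2 - penalty (φ i) _ at h6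
  rw [Real.norm_eq_abs]
  simp only [Pi.add_apply]
  have a1 := le_abs_self (penalty (φ i) (f i t))
  have a2 := le_abs_self (penalty (φ i) (g i t))
  have a3 := abs_nonneg (penalty (φ i) (f i t))
  have a4 := abs_nonneg (penalty (φ i) (g i t))
  have a5 := (abs_nonneg _).trans h4
  rw [abs_le]
  constructor <;> linarith [(abs_le.1 h4).2]

/-- Concavity of the dual functional, with the gap contributed by the penalties. -/
theorem realDual_midpoint_ge (S : Setting μ γ φ c ε C L) {M : ℝ} {f g : ∀ i, X i → ℝ}
    (hf : Admissible μ γ φ M f) (hg : Admissible μ γ φ M g) :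
    (realDual μ γ φ c ε f + realDual μ γ φ c ε g) / 2 +
        ∑ i, ∫ t, midGap (fun q => (conj (φ i) q).toReal) (-f i t) (-g i t) ∂μ i ≤
      realDual μ γ φ c ε (fun i t => (f i t + g i t) / 2) := by
  have hm := hf.midpoint S hg
  have hε := S.eps_pos
  have hpf := integrable_plan hε S.measurable_cost S.abs_cost_le hf.1
  have hpg := integrable_plan hε S.measurable_cost S.abs_cost_le hg.1
  have hpm := integrable_plan hε S.measurable_cost S.abs_cost_le hm.1
  have hplan : ∫ x, plan c ε (fun i t => (f i t + g i t) / 2) x ∂Measure.pi γ ≤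
      (∫ x, plan c ε f x ∂Measure.pi γ + ∫ x, plan c ε g x ∂Measure.pi γ) / 2 := by
    rw [← integral_add hpf hpg, ← integral_div]
    refine integral_mono hpm ((hpf.add hpg).div_const 2) fun x => ?_
    have := midGap_nonneg convexOn_exp (Set.mem_univ ((∑ i, f i (x i) - c x) / ε))
      (Set.mem_univ ((∑ i, g i (x i) - c x) / ε))
    unfold midGap at this
    simp only [plan]
    rw [show ((∑ i, f i (x i) - c x) / ε + (∑ i, g i (x i) - c x) / ε) / 2 =
      (∑ i, (f i (x i) + g i (x i)) / 2 - c x) / ε by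
        rw [← Finset.sum_div, Finset.sum_add_distrib]; ring] at this
    linarith
  have hpen : ∀ i, ∫ t, midGap (fun q => (conj (φ i) q).toReal) (-f i t) (-g i t) ∂μ i =
      (∫ t, penalty (φ i) (f i t) ∂μ i) / 2 + (∫ t, penalty (φ i) (g i t) ∂μ i) / 2 -
        ∫ t, penalty (φ i) ((f i t + g i t) / 2) ∂μ i := fun i => by
    have hadd : Integrable (fun t => penalty (φ i) (f i t) / 2 + penalty (φ i) (g i t) / 2) (μ i) :=
      ((hf.2 i).2.div_const 2).add ((hg.2 i).2.div_const 2)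
    rw [← integral_div, ← integral_div, ← integral_add ((hf.2 i).2.div_const 2)
      ((hg.2 i).2.div_const 2), ← integral_sub hadd (hm.2 i).2]
    refine integral_congr_ae (ae_of_all _ fun t => ?_)
    simp only [midGap, penalty]
    rw [show (-f i t + -g i t) / 2 = -((f i t + g i t) / 2) by ring]
  rw [realDual_eq S hf.1, realDual_eq S hg.1, realDual_eq S hm.1]
  simp only [hpen]
  rw [Finset.sum_sub_distrib, Finset.sum_add_distrib, ← Finset.sum_div, ← Finset.sum_div]
  have := mul_le_mul_of_nonneg_left hplan hε.le
  linarith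

end Dual

/-! ### Bounds and continuity of the dual functional -/

section Estimates

set_option linter.unusedSectionVars false

variable {N : ℕ} {X : Fin N → Type*} [∀ i, MeasurableSpace (X i)]
  {μ γ : ∀ i, Measure (X i)} [∀ i, IsFiniteMeasure (μ i)] [∀ i, IsFiniteMeasure (γ i)]
  {φ : Fin N → ℝ → EReal} {c : (∀ i, X i) → ℝ} {ε C L : ℝ}

theorem pi_real_univ_pos (S : Setting μ γ φ c ε C L) : 0 < (Measure.pi γ).real Set.univ := by
  rw [measureReal_def]
  refine ENNReal.toReal_pos ?_ (measure_ne_top _ _)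
  rw [Measure.pi_univ]
  exact Finset.prod_ne_zero_iff.2 fun i _ =>
    Measure.measure_univ_ne_zero.2 (S.reference_ne_zero i)

theorem marginal_real_univ_pos (S : Setting μ γ φ c ε C L) (i : Fin N) :
    0 < (μ i).real Set.univ := by
  rw [measureReal_def]
  exact ENNReal.toReal_pos (Measure.measure_univ_ne_zero.2 (S.ne_zero i)) (measure_ne_top _ _)

theorem realDual_le (S : Setting μ γ φ c ε C L) {M : ℝ} {f : ∀ i, X i → ℝ}
    (hf : Admissible μ γ φ M f) : realDual μ γ φ c ε f ≤
      ∑ i, M * (μ i).real Set.univ + ε * (Measure.pi γ).real Set.univ := by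
  rw [realDual_eq S hf.1]
  have h1 : 0 ≤ ε * ∫ x, plan c ε f x ∂Measure.pi γ :=
    mul_nonneg S.eps_pos.le (integral_nonneg fun x => (plan_pos ..).le)
  have h2 : ∑ i, -(M * (μ i).real Set.univ) ≤ ∑ i, ∫ t, penalty (φ i) (f i t) ∂μ i := by
    refine Finset.sum_le_sum fun i _ => ?_
    have : ∫ _, -M ∂μ i = -(M * (μ i).real Set.univ) := by
      rw [integral_const, smul_eq_mul]; ring
    rw [← this]
    refine integral_mono_ae (integrable_const _) (hf.2 i).2 ?_
    filter_upwards [(S.ac i).ae_le (hf.2 i).1, (S.ac i).ae_le (hf.1 i).2] with t h1 h2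
    linarith [neg_le_penalty (S.entropy i) h1, (abs_le.1 h2).2]
  rw [Finset.sum_neg_distrib] at h2
  linarith

/-- Coercivity: potentials of oscillation at most `K` with a lower bound on the dual functional
are close to bounded constants. -/
theorem exists_abs_center_le (S : Setting μ γ φ c ε C L) {A B D K : ℝ} (hA : 0 < A) (hAB : A < B)
    (hgrow : ∀ i, ∀ q ∈ dom (conj (φ i)),
      -((μ i).real Set.univ * (conj (φ i) q).toReal) ≤ min (A * -q) (B * -q) + D)
    (hK : 0 ≤ K) (d : ℝ) :
    ∃ M' : ℝ, ∀ (M : ℝ) (f : ∀ i, X i → ℝ) (a : Fin N → ℝ), Admissible μ γ φ M f →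
      (∀ i, ∀ᵐ t ∂γ i, |f i t - a i| ≤ K) → d ≤ realDual μ γ φ c ε f → ∀ i, |a i| ≤ M' := by
  have hε := S.eps_pos
  set Γ := (Measure.pi γ).real Set.univ with hΓ
  have hΓpos : 0 < Γ := pi_real_univ_pos S
  obtain ⟨M', hM'⟩ := exists_abs_le_of_le_sum_min_sub_exp (ι := Fin N) hA hAB
    (show 0 < ε * (Γ * Real.exp (-(N * K + C) / ε)) by positivity) hε
    (d - (∑ _i : Fin N, (B * K + D) + ε * Γ))
  refine ⟨M', fun M f a hf ha hd => hM' a ?_⟩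
  have hpen : ∀ i, -∫ t, penalty (φ i) (f i t) ∂μ i ≤ min (A * a i) (B * a i) + (B * K + D) := by
    intro i
    have hm := marginal_real_univ_pos S i
    have h1 : ∫ t, -((μ i).real Set.univ * penalty (φ i) (f i t)) ∂μ i ≤
        ∫ _, (min (A * a i) (B * a i) + (B * K + D)) ∂μ i := by
      refine integral_mono_ae ((hf.2 i).2.const_mul _).neg (integrable_const _) ?_
      filter_upwards [(S.ac i).ae_le (hf.2 i).1, (S.ac i).ae_le (ha i)] with t h1 h2
      have h3 := hgrow i _ h1
      rw [neg_neg] at h3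
      have h4 := (abs_le.1 h2).2
      have h5 : min (A * f i t) (B * f i t) ≤ min (A * a i) (B * a i) + B * K := by
        rw [← min_add_add_right]
        refine min_le_min ?_ ?_
        · nlinarith
        · nlinarith
      change -((μ i).real Set.univ * (conj (φ i) (-f i t)).toReal) ≤ _
      linarith
    rw [integral_neg, integral_const_mul, integral_const, smul_eq_mul, ← mul_neg] at h1
    exact le_of_mul_le_mul_left h1 hm
  have hplan : Γ * Real.exp (-(N * K + C) / ε) * Real.exp ((∑ i, a i) / ε) ≤
      ∫ x, plan c ε f x ∂Measure.pi γ := by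
    have h1 : ∫ _, Real.exp ((∑ i, a i - (N * K + C)) / ε) ∂Measure.pi γ =
        Γ * Real.exp (-(N * K + C) / ε) * Real.exp ((∑ i, a i) / ε) := by
      rw [integral_const, smul_eq_mul, mul_assoc, ← Real.exp_add]
      congr 2; ring
    rw [← h1]
    refine integral_mono_ae (integrable_const _)
      (integrable_plan hε S.measurable_cost S.abs_cost_le hf.1) ?_
    have hall : ∀ᵐ x ∂Measure.pi γ, ∀ i, |f i (x i) - a i| ≤ K :=
      ae_all_iff.2 fun i => ae_pi_comp_eval (ha i)
    filter_upwards [hall] with x hx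
    refine Real.exp_le_exp.2 (div_le_div_of_nonneg_right ?_ hε.le)
    have h2 := abs_sum_le_of_abs_le hx
    rw [Fintype.card_fin, Finset.sum_sub_distrib] at h2
    linarith [(abs_le.1 h2).1, (abs_le.1 (S.abs_cost_le x)).2]
  rw [realDual_eq S hf.1] at hd
  have hsum := Finset.sum_le_sum fun i (_ : i ∈ Finset.univ) => hpen i
  rw [Finset.sum_neg_distrib, Finset.sum_add_distrib] at hsum
  have := mul_le_mul_of_nonneg_left hplan hε.le
  rw [← mul_assoc, ← mul_assoc] at this
  rw [← mul_assoc]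
  linarith

/-- `exp` is Lipschitz with constant `exp T` on `(-∞, T]`. -/
theorem abs_exp_sub_exp_le {a b T : ℝ} (ha : a ≤ T) (hb : b ≤ T) :
    |Real.exp a - Real.exp b| ≤ Real.exp T * |a - b| := by
  have key : ∀ {a b : ℝ}, a ≤ T → Real.exp a - Real.exp b ≤ Real.exp T * |a - b| := by
    intro a b ha
    have h1 := Real.add_one_le_exp (b - a)
    have h2 : Real.exp b = Real.exp a * Real.exp (b - a) := by rw [← Real.exp_add]; ring_nf
    have h3 := mul_le_mul_of_nonneg_left h1 (Real.exp_pos a).le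
    calc Real.exp a - Real.exp b ≤ Real.exp a * (a - b) := by rw [h2]; linarith
      _ ≤ Real.exp a * |a - b| := mul_le_mul_of_nonneg_left (le_abs_self _) (Real.exp_pos a).le
      _ ≤ _ := mul_le_mul_of_nonneg_right (Real.exp_le_exp.2 ha) (abs_nonneg _)
  rw [abs_le]
  constructor
  · have := key (a := b) (b := a) hb; rw [abs_sub_comm] at this; linarith
  · exact key ha

theorem integral_comp_eval (γ : ∀ i, Measure (X i)) [∀ i, IsFiniteMeasure (γ i)] {i : Fin N}
    {h : X i → ℝ} (hh : AEStronglyMeasurable h (γ i)) :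
    ∫ x, h (x i) ∂Measure.pi γ =
      (∏ k ∈ Finset.univ.erase i, γ k Set.univ).toReal * ∫ t, h t ∂γ i := by
  rw [← smul_eq_mul, ← integral_smul_measure, ← Measure.pi_map_eval]
  refine (integral_map (measurable_pi_apply i).aemeasurable ?_).symm
  rw [Measure.pi_map_eval]
  exact hh.smul_measure _

/-- On bounded potentials the total mass of the plan is Lipschitz in the `L¹` norm. -/
theorem exists_abs_integral_plan_sub_le (S : Setting μ γ φ c ε C L) (M : ℝ) :
    ∃ R : ℝ, ∀ f g : ∀ i, X i → ℝ, EssBdd γ M f → EssBdd γ M g →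
      |∫ x, plan c ε f x ∂Measure.pi γ - ∫ x, plan c ε g x ∂Measure.pi γ| ≤
        R * ∑ i, ∫ t, |f i t - g i t| ∂γ i := by
  have hε := S.eps_pos
  set w : Fin N → ℝ := fun i => (∏ k ∈ Finset.univ.erase i, γ k Set.univ).toReal with hw
  have hw0 : ∀ i, 0 ≤ w i := fun i => ENNReal.toReal_nonneg
  set T := Real.exp ((N * M + C) / ε) / ε with hT
  have hT0 : 0 ≤ T := by positivity
  refine ⟨T * ∑ i, w i, fun f g hf hg => ?_⟩
  have hpf := integrable_plan hε S.measurable_cost S.abs_cost_le hf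
  have hpg := integrable_plan hε S.measurable_cost S.abs_cost_le hg
  have hd : ∀ i, Integrable (fun t => |f i t - g i t|) (γ i) := fun i =>
    ((hf.integrable i).sub (hg.integrable i)).abs
  have hd' : ∀ i, Integrable (fun x : ∀ i, X i => |f i (x i) - g i (x i)|) (Measure.pi γ) :=
    fun i => integrable_comp_eval (hd i)
  rw [← integral_sub hpf hpg]
  have h1 : ∫ x, |plan c ε f x - plan c ε g x| ∂Measure.pi γ ≤
      ∫ x, T * ∑ i, |f i (x i) - g i (x i)| ∂Measure.pi γ := by
    refine integral_mono_ae (hpf.sub hpg).abs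
      ((integrable_finsetSum _ fun i _ => hd' i).const_mul T) ?_
    filter_upwards [hf.ae_pi, hg.ae_pi] with x h1 h2
    have h3 : (∑ i, f i (x i) - c x) / ε ≤ (N * M + C) / ε :=
      div_le_div_of_nonneg_right
        ((le_abs_self _).trans (abs_log_plan_le S.abs_cost_le h1)) hε.le
    have h4 : (∑ i, g i (x i) - c x) / ε ≤ (N * M + C) / ε :=
      div_le_div_of_nonneg_right
        ((le_abs_self _).trans (abs_log_plan_le S.abs_cost_le h2)) hε.le
    refine (abs_exp_sub_exp_le h3 h4).trans ?_
    rw [← sub_div, sub_sub_sub_cancel_right, ← Finset.sum_sub_distrib, abs_div, abs_of_pos hε, hT,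
      div_mul_eq_mul_div, mul_div_assoc]
    exact mul_le_mul_of_nonneg_left (div_le_div_of_nonneg_right
      (Finset.abs_sum_le_sum_abs _ _) hε.le) (Real.exp_pos _).le
  refine (abs_integral_le_integral_abs.trans h1).trans ?_
  rw [integral_const_mul, integral_finsetSum _ fun i _ => hd' i, mul_assoc]
  refine mul_le_mul_of_nonneg_left ?_ hT0
  rw [Finset.sum_mul_sum]
  refine Finset.sum_le_sum fun i _ => ?_
  rw [integral_comp_eval γ (h := fun t => |f i t - g i t|) (hd i).aestronglyMeasurable]
  exact Finset.single_le_sum (f := fun k => w i * ∫ t, |f k t - g k t| ∂γ k)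
    (fun k _ => mul_nonneg (hw0 i) (integral_nonneg fun t => abs_nonneg _)) (Finset.mem_univ i)

theorem plan_eq_sq (c : (∀ i, X i) → ℝ) (hε : 0 < ε) (f : ∀ i, X i → ℝ) (x : ∀ i, X i) :
    plan c ε f x = plan c (2 * ε) f x ^ 2 := by
  unfold plan
  rw [← Real.exp_nat_mul]; congr 1; push_cast; field_simp

/-- Plans that are close in the Hellinger distance are close in `L¹`. -/
theorem exists_integral_abs_plan_sub_le (S : Setting μ γ φ c ε C L) (M : ℝ) :
    ∃ T : ℝ, 0 ≤ T ∧ ∀ f g : ∀ i, X i → ℝ, EssBdd γ M f → EssBdd γ M g → ∀ τ : ℝ, 0 < τ →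
      ∫ x, |plan c ε f x - plan c ε g x| ∂Measure.pi γ ≤ T * τ + T / τ *
        ∫ x, (plan c (2 * ε) f x - plan c (2 * ε) g x) ^ 2 ∂Measure.pi γ := by
  have hε := S.eps_pos
  have hε2 : 0 < 2 * ε := by positivity
  set Γ := (Measure.pi γ).real Set.univ with hΓ
  have hΓ0 : 0 ≤ Γ := measureReal_nonneg
  set T₀ := Real.exp ((N * M + C) / (2 * ε)) with hT₀
  have hT0 : 0 < T₀ := Real.exp_pos _
  refine ⟨T₀ * (Γ + 1), by positivity, fun f g hf hg τ hτ => ?_⟩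
  have hpf := integrable_plan hε S.measurable_cost S.abs_cost_le hf
  have hpg := integrable_plan hε S.measurable_cost S.abs_cost_le hg
  have hsf := integrable_plan hε2 S.measurable_cost S.abs_cost_le hf
  have hsg := integrable_plan hε2 S.measurable_cost S.abs_cost_le hg
  have hsq : Integrable (fun x => (plan c (2 * ε) f x - plan c (2 * ε) g x) ^ 2)
      (Measure.pi γ) := by
    refine integrable_of_ae_abs_le (K := (2 * T₀) ^ 2)
      ((hsf.sub hsg).aestronglyMeasurable.pow 2) ?_
    filter_upwards [hf.ae_pi, hg.ae_pi] with x h1 h2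
    have h3 := plan_le hε2 S.abs_cost_le h1
    have h4 := plan_le hε2 S.abs_cost_le h2
    have h5 := plan_pos c (2 * ε) f x
    have h6 := plan_pos c (2 * ε) g x
    rw [abs_of_nonneg (sq_nonneg _)]
    exact sq_le_sq' (by linarith) (by linarith)
  have h1 : ∫ x, |plan c ε f x - plan c ε g x| ∂Measure.pi γ ≤
      ∫ x, (T₀ * τ + T₀ / τ * (plan c (2 * ε) f x - plan c (2 * ε) g x) ^ 2) ∂Measure.pi γ := by
    refine integral_mono_ae (hpf.sub hpg).abs ((integrable_const _).add (hsq.const_mul _)) ?_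
    filter_upwards [hf.ae_pi, hg.ae_pi] with x h1 h2
    have h3 := plan_le hε2 S.abs_cost_le h1
    have h4 := plan_le hε2 S.abs_cost_le h2
    have h5 := plan_pos c (2 * ε) f x
    have h6 := plan_pos c (2 * ε) g x
    rw [plan_eq_sq c hε f, plan_eq_sq c hε g]
    set a := plan c (2 * ε) f x
    set b := plan c (2 * ε) g x
    have h7 : |a ^ 2 - b ^ 2| ≤ 2 * T₀ * |a - b| := by
      rw [sq_sub_sq, abs_mul, abs_of_pos (by linarith : 0 < a + b)]
      exact mul_le_mul_of_nonneg_right (by linarith) (abs_nonneg _)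
    have h8 : 2 * |a - b| ≤ τ + (a - b) ^ 2 / τ := by
      have : 0 ≤ (|a - b| - τ) ^ 2 / τ := by positivity
      have e : (|a - b| - τ) ^ 2 / τ = (a - b) ^ 2 / τ - 2 * |a - b| + τ := by
        rw [sub_sq, sq_abs]; field_simp
      linarith
    have h9 := mul_le_mul_of_nonneg_left h8 hT0.le
    have e : T₀ * (τ + (a - b) ^ 2 / τ) = T₀ * τ + T₀ / τ * (a - b) ^ 2 := by ring
    linarith
  refine h1.trans ?_
  rw [integral_add (integrable_const _) (hsq.const_mul _), integral_const, integral_const_mul,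
    smul_eq_mul, ← hΓ]
  have hI : 0 ≤ ∫ x, (plan c (2 * ε) f x - plan c (2 * ε) g x) ^ 2 ∂Measure.pi γ :=
    integral_nonneg fun x => sq_nonneg _
  have e1 : Γ * (T₀ * τ) ≤ T₀ * (Γ + 1) * τ := by nlinarith [mul_pos hT0 hτ]
  have e2 : T₀ / τ ≤ T₀ * (Γ + 1) / τ := by
    apply div_le_div_of_nonneg_right _ hτ.le; nlinarith
  linarith [mul_le_mul_of_nonneg_right e2 hI]

theorem tendsto_integral_abs_plan_sub (S : Setting μ γ φ c ε C L) {M : ℝ}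
    {f g : ℕ → ∀ i, X i → ℝ} (hf : ∀ n, EssBdd γ M (f n)) (hg : ∀ n, EssBdd γ M (g n))
    (h : Tendsto (fun n => ∫ x, (plan c (2 * ε) (f n) x - plan c (2 * ε) (g n) x) ^ 2
      ∂Measure.pi γ) atTop (𝓝 0)) :
    Tendsto (fun n => ∫ x, |plan c ε (f n) x - plan c ε (g n) x| ∂Measure.pi γ) atTop (𝓝 0) := by
  obtain ⟨T, hT, hle⟩ := exists_integral_abs_plan_sub_le S M
  -- this choice of `τ` makes the first error term at most `δ / 2`
  rw [Metric.tendsto_atTop]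
  intro δ hδ
  have hτ : 0 < δ / (2 * (T + 1)) := by positivity
  have h1 := (h.const_mul (T / (δ / (2 * (T + 1))))).eventually_lt_const
    (show T / (δ / (2 * (T + 1))) * 0 < δ / 2 by rw [mul_zero]; positivity)
  obtain ⟨n₀, hn₀⟩ := eventually_atTop.1 h1
  refine ⟨n₀, fun n hn => ?_⟩
  rw [Real.dist_eq, sub_zero, abs_of_nonneg (integral_nonneg fun x => abs_nonneg _)]
  have h2 := hle (f n) (g n) (hf n) (hg n) _ hτ
  have h3 := hn₀ n hn
  have h4 : T * (δ / (2 * (T + 1))) ≤ δ / 2 := by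
    rw [← mul_div_assoc, div_le_div_iff₀ (by positivity) (by positivity)]
    nlinarith
  linarith

end Estimates

/-! ### Convergence of bounded sequences of functions -/

section Convergence

variable {α : Type*} [MeasurableSpace α] {ν : Measure α}

theorem eLpNorm_one_eq_ofReal_integral_abs {h : α → ℝ} (hh : Integrable h ν) :
    eLpNorm h 1 ν = ENNReal.ofReal (∫ t, |h t| ∂ν) := by
  rw [eLpNorm_one_eq_lintegral_enorm, ← ofReal_integral_norm_eq_lintegral_enorm hh]
  simp only [Real.norm_eq_abs]

variable [IsFiniteMeasure ν]

/-- Completeness of `L¹` for bounded sequences, with an almost everywhere convergent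
subsequence. -/
theorem exists_limit_of_cauchy {h : ℕ → α → ℝ} {M : ℝ}
    (hm : ∀ n, AEStronglyMeasurable (h n) ν) (hb : ∀ n, ∀ᵐ t ∂ν, |h n t| ≤ M)
    (hc : ∀ δ > 0, ∃ n₀, ∀ n ≥ n₀, ∀ m ≥ n₀, ∫ t, |h n t - h m t| ∂ν ≤ δ) :
    ∃ k : α → ℝ, AEStronglyMeasurable k ν ∧ (∀ᵐ t ∂ν, |k t| ≤ M) ∧
      Tendsto (fun n => ∫ t, |h n t - k t| ∂ν) atTop (𝓝 0) ∧
      ∃ ns : ℕ → ℕ, StrictMono ns ∧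
        ∀ᵐ t ∂ν, Tendsto (fun i => h (ns i) t) atTop (𝓝 (k t)) := by
  have hi : ∀ n, Integrable (h n) ν := fun n => integrable_of_ae_abs_le (hm n) (hb n)
  have hL : ∀ n, MemLp (h n) 1 ν := fun n => memLp_one_iff_integrable.2 (hi n)
  have hcs : CauchySeq fun n => (hL n).toLp (h n) := by
    rw [Metric.cauchySeq_iff]
    intro δ hδ
    obtain ⟨n₀, hn₀⟩ := hc (δ / 2) (by positivity)
    refine ⟨n₀, fun n hn m hm' => ?_⟩
    rw [dist_edist, Lp.edist_toLp_toLp, eLpNorm_one_eq_ofReal_integral_abs ((hi n).sub (hi m)),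
      ENNReal.toReal_ofReal (integral_nonneg fun t => abs_nonneg _)]
    have := hn₀ n hn m hm'
    simp only [Pi.sub_apply]
    linarith
  obtain ⟨k, hk⟩ := cauchySeq_tendsto_of_complete hcs
  have hk1 : Tendsto (fun n => eLpNorm (h n - ⇑k) 1 ν) atTop (𝓝 0) := by
    rw [Lp.tendsto_Lp_iff_tendsto_eLpNorm'] at hk
    refine hk.congr fun n => eLpNorm_congr_ae ?_
    filter_upwards [(hL n).coeFn_toLp] with t ht
    simp [ht]
  have hki : Integrable (⇑k) ν := L1.integrable_coeFn k
  obtain ⟨ns, hns, hae⟩ := (tendstoInMeasure_of_tendsto_eLpNorm one_ne_zero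
    (fun n => hm n) (Lp.aestronglyMeasurable k) hk1).exists_seq_tendsto_ae
  refine ⟨k, Lp.aestronglyMeasurable k, ?_, ?_, ns, hns, hae⟩
  · filter_upwards [hae, ae_all_iff.2 hb] with t h1 h2
    exact le_of_tendsto h1.abs (Eventually.of_forall fun i => h2 (ns i))
  · have h2 : Tendsto (fun n => (eLpNorm (h n - ⇑k) 1 ν).toReal) atTop (𝓝 0) := by
      exact (ENNReal.tendsto_toReal ENNReal.zero_ne_top).comp hk1
    refine h2.congr fun n => ?_
    rw [eLpNorm_one_eq_ofReal_integral_abs ((hi n).sub hki),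
      ENNReal.toReal_ofReal (integral_nonneg fun t => abs_nonneg _)]
    rfl

/-- For bounded sequences, convergence in `L¹` implies convergence in `L^r`, `r < ∞`. -/
theorem tendsto_eLpNorm_of_tendsto_integral {h : ℕ → α → ℝ} {K : ℝ}
    (hm : ∀ n, AEStronglyMeasurable (h n) ν) (hb : ∀ᶠ n in atTop, ∀ᵐ t ∂ν, |h n t| ≤ K)
    (hlim : Tendsto (fun n => ∫ t, |h n t| ∂ν) atTop (𝓝 0)) {r : ℝ≥0∞} (h1 : 1 ≤ r)
    (hr : r ≠ ∞) : Tendsto (fun n => eLpNorm (h n) r ν) atTop (𝓝 0) := by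
  have hr0 : r ≠ 0 := fun h0 => by simp [h0] at h1
  have hr1 : 1 ≤ r.toReal := by
    rw [← ENNReal.toReal_one]; exact (ENNReal.toReal_le_toReal ENNReal.one_ne_top hr).2 h1
  have hK : ∀ᶠ n in atTop, eLpNorm (h n) r ν ≤
      (ENNReal.ofReal K ^ (r.toReal - 1) * ENNReal.ofReal (∫ t, |h n t| ∂ν)) ^
        (1 / r.toReal) := by
    filter_upwards [hb] with n hn
    rw [eLpNorm_eq_lintegral_rpow_enorm_toReal hr0 hr]
    refine ENNReal.rpow_le_rpow ?_ (by positivity)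
    rw [← eLpNorm_one_eq_ofReal_integral_abs (integrable_of_ae_abs_le (hm n) hn),
      eLpNorm_one_eq_lintegral_enorm, ← lintegral_const_mul'' _ (hm n).enorm]
    refine lintegral_mono_ae ?_
    filter_upwards [hn] with t ht
    have h2 : ‖h n t‖ₑ ≤ ENNReal.ofReal K := by
      rw [Real.enorm_eq_ofReal_abs]; exact ENNReal.ofReal_le_ofReal ht
    calc ‖h n t‖ₑ ^ r.toReal = ‖h n t‖ₑ ^ (r.toReal - 1) * ‖h n t‖ₑ ^ (1 : ℝ) := by
          rw [← ENNReal.rpow_add_of_nonneg _ _ (by linarith) zero_le_one]; congr 1; ring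
      _ ≤ _ := by
          rw [ENNReal.rpow_one]
          exact mul_le_mul_left (ENNReal.rpow_le_rpow h2 (by linarith)) _
  have hpow : ENNReal.ofReal K ^ (r.toReal - 1) ≠ ∞ :=
    ENNReal.rpow_ne_top_of_nonneg (by linarith) ENNReal.ofReal_ne_top
  have hz : Tendsto (fun n => (ENNReal.ofReal K ^ (r.toReal - 1) *
      ENNReal.ofReal (∫ t, |h n t| ∂ν)) ^ (1 / r.toReal)) atTop (𝓝 0) := by
    have h2 : Tendsto (fun n => ENNReal.ofReal (∫ t, |h n t| ∂ν)) atTop (𝓝 0) := by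
      simpa using ENNReal.tendsto_ofReal hlim
    have h3 := ENNReal.Tendsto.const_mul h2 (Or.inr hpow)
    have h4 := (ENNReal.continuous_rpow_const (y := 1 / r.toReal)).tendsto
      (ENNReal.ofReal K ^ (r.toReal - 1) * 0) |>.comp h3
    rw [mul_zero, ENNReal.zero_rpow_of_pos (by positivity)] at h4
    exact h4
  exact tendsto_of_tendsto_of_tendsto_of_le_of_le' tendsto_const_nhds hz
    (Eventually.of_forall fun _ => zero_le) hK

end Convergence

/-! ### The extended-valued dual functional -/

section Extended

set_option linter.unusedSectionVars false

/-- The extended integral agrees with the Bochner integral where the latter is meaningful. -/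
theorem extIntegral_eq_coe {α : Type*} [MeasurableSpace α] {ν : Measure α} {g : α → EReal}
    {u : α → ℝ} (hu : Integrable u ν) (hgu : ∀ᵐ t ∂ν, g t = (u t : EReal)) :
    extIntegral ν g = ((∫ t, u t ∂ν : ℝ) : EReal) := by
  unfold extIntegral
  have h1 : ∫⁻ t, (g t).toENNReal ∂ν = ∫⁻ t, ENNReal.ofReal (u t) ∂ν := by
    refine lintegral_congr_ae ?_
    filter_upwards [hgu] with t ht
    rw [ht, EReal.toENNReal_of_ne_top (EReal.coe_ne_top _), EReal.toReal_coe]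
  have h2 : ∫⁻ t, (-g t).toENNReal ∂ν = ∫⁻ t, ENNReal.ofReal (-u t) ∂ν := by
    refine lintegral_congr_ae ?_
    filter_upwards [hgu] with t ht
    rw [ht, ← EReal.coe_neg, EReal.toENNReal_of_ne_top (EReal.coe_ne_top _), EReal.toReal_coe]
  have f1 : ∫⁻ t, ENNReal.ofReal (u t) ∂ν ≠ ∞ := hu.lintegral_lt_top.ne
  have f2 : ∫⁻ t, ENNReal.ofReal (-u t) ∂ν ≠ ∞ := hu.neg.lintegral_lt_top.ne
  rw [h1, h2, integral_eq_lintegral_pos_part_sub_lintegral_neg_part hu, EReal.coe_sub,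
    EReal.coe_ennreal_toReal f1, EReal.coe_ennreal_toReal f2]

theorem coe_sum_ereal {ι : Type*} (s : Finset ι) (a : ι → ℝ) :
    ((∑ i ∈ s, a i : ℝ) : EReal) = ∑ i ∈ s, (a i : EReal) := by
  classical
  induction s using Finset.induction_on with
  | empty => simp
  | insert i s hi ih => rw [Finset.sum_insert hi, Finset.sum_insert hi, EReal.coe_add, ih]

variable {N : ℕ} {X : Fin N → Type*} [∀ i, MeasurableSpace (X i)]
  {μ γ : ∀ i, Measure (X i)} [∀ i, IsFiniteMeasure (μ i)] [∀ i, IsFiniteMeasure (γ i)]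
  {φ : Fin N → ℝ → EReal} {c : (∀ i, X i) → ℝ} {ε C L : ℝ}

theorem dualFunctional_eq_coe (S : Setting μ γ φ c ε C L) {M : ℝ} {f : ∀ i, X i → ℝ}
    (hf : Admissible μ γ φ M f) :
    dualFunctional μ γ φ c ε f = (realDual μ γ φ c ε f : EReal) := by
  unfold dualFunctional realDual
  have h : ∀ i, extIntegral (μ i) (fun t => conj (φ i) (-f i t)) =
      ((∫ t, penalty (φ i) (f i t) ∂μ i : ℝ) : EReal) := fun i => by
    refine extIntegral_eq_coe (hf.2 i).2 ?_
    filter_upwards [(S.ac i).ae_le (hf.2 i).1] with t ht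
    exact (coe_toReal_conj ht).symm
  simp only [h]
  rw [← coe_sum_ereal, ← EReal.coe_neg, ← EReal.coe_sub]
  rfl

/-- The negative part of a penalty is integrable for bounded potentials, as `q ≤ φ^* q`. The
extended integral of a penalty is therefore never `-∞`. -/
theorem lintegral_toENNReal_neg_conj_ne_top (S : Setting μ γ φ c ε C L) {M : ℝ}
    {f : ∀ i, X i → ℝ} (hf : EssBdd γ M f) (i : Fin N) :
    ∫⁻ t, (-conj (φ i) (-f i t)).toENNReal ∂μ i ≠ ∞ := by
  have hi := (hf.integrable_marginal S i).lintegral_lt_top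
  refine ne_top_of_le_ne_top hi.ne (lintegral_mono fun t => ?_)
  have h1 := le_conj (S.entropy i) (-f i t)
  have h2 : -conj (φ i) (-f i t) ≤ ((f i t : ℝ) : EReal) := by
    rw [EReal.neg_le]; exact_mod_cast h1
  have := EReal.toENNReal_le_toENNReal h2
  rwa [EReal.toENNReal_of_ne_top (EReal.coe_ne_top _), EReal.toReal_coe] at this

/-- Bounded potentials with a finite value of the dual functional are admissible. -/
theorem admissible_of_dualFunctional_ne_bot (S : Setting μ γ φ c ε C L) {M : ℝ}
    {f : ∀ i, X i → ℝ} (hf : EssBdd γ M f) (hd : dualFunctional μ γ φ c ε f ≠ ⊥) :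
    Admissible μ γ φ M f := by
  have hbot : ∀ i, extIntegral (μ i) (fun t => conj (φ i) (-f i t)) ≠ ⊥ := fun i h => by
    unfold extIntegral at h
    rw [sub_eq_add_neg, EReal.add_eq_bot_iff] at h
    rcases h with h | h
    · exact EReal.coe_ennreal_ne_bot _ h
    · rw [EReal.neg_eq_bot_iff, EReal.coe_ennreal_eq_top_iff] at h
      exact lintegral_toENNReal_neg_conj_ne_top S hf i h
  have hpos : ∀ i, ∫⁻ t, (conj (φ i) (-f i t)).toENNReal ∂μ i ≠ ∞ := by
    intro i h
    apply hd
    have htop : extIntegral (μ i) (fun t => conj (φ i) (-f i t)) = ⊤ := by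
      unfold extIntegral
      rw [h, ← EReal.coe_ennreal_toReal (lintegral_toENNReal_neg_conj_ne_top S hf i)]
      simp
    have hsum : ∑ i, extIntegral (μ i) (fun t => conj (φ i) (-f i t)) = ⊤ := by
      rw [← Finset.add_sum_erase _ _ (Finset.mem_univ i), htop]
      refine EReal.top_add_of_ne_bot ?_
      have : ∀ s : Finset (Fin N),
          ∑ i ∈ s, extIntegral (μ i) (fun t => conj (φ i) (-f i t)) ≠ ⊥ := by
        intro s
        induction s using Finset.induction_on with
        | empty => simp
        | insert a s ha ih =>
          rw [Finset.sum_insert ha, Ne, EReal.add_eq_bot_iff, not_or]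
          exact ⟨hbot a, ih⟩
      exact this _
    unfold dualFunctional
    rw [hsum, EReal.neg_top, EReal.bot_sub]
  refine ⟨hf, fun i => ?_⟩
  have hmeas : AEMeasurable (fun t => conj (φ i) (-f i t)) (μ i) :=
    (measurable_conj (S.entropy i)).comp_aemeasurable
      ((hf i).1.mono_ac (S.ac i)).aemeasurable.neg
  have hfin : ∀ᵐ t ∂μ i, -f i t ∈ dom (conj (φ i)) := by
    have h1 : AEMeasurable (fun t => (conj (φ i) (-f i t)).toENNReal) (μ i) :=
      measurable_ereal_toENNReal.comp_aemeasurable hmeas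
    filter_upwards [ae_lt_top' h1 (hpos i)] with t ht
    rw [mem_dom_conj_iff (S.entropy i)]
    intro h
    simp [h] at ht
  refine ⟨(S.reference_ac i).ae_le hfin, ?_⟩
  refine ⟨aestronglyMeasurable_penalty S (hf i).1, ?_⟩
  have hb : ∫⁻ t, ((conj (φ i) (-f i t)).toENNReal + (-conj (φ i) (-f i t)).toENNReal) ∂μ i
      < ∞ := by
    have h1 : AEMeasurable (fun t => (conj (φ i) (-f i t)).toENNReal) (μ i) :=
      measurable_ereal_toENNReal.comp_aemeasurable hmeas
    rw [lintegral_add_left' h1]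
    exact ENNReal.add_lt_top.2 ⟨(hpos i).lt_top,
      (lintegral_toENNReal_neg_conj_ne_top S hf i).lt_top⟩
  refine lt_of_le_of_lt (lintegral_mono_ae ?_) hb
  filter_upwards [hfin] with t ht
  rw [← coe_toReal_conj ht, ← EReal.coe_neg, EReal.toENNReal_of_ne_top (EReal.coe_ne_top _),
    EReal.toENNReal_of_ne_top (EReal.coe_ne_top _), EReal.toReal_coe, EReal.toReal_coe,
    Real.enorm_eq_ofReal_abs]
  change ENNReal.ofReal |(conj (φ i) (-f i t)).toReal| ≤ _
  rcases abs_cases (conj (φ i) (-f i t)).toReal with ⟨h, -⟩ | ⟨h, -⟩ <;> rw [h]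
  · exact le_self_add
  · exact le_add_self

end Extended

/-! ### Sinkhorn sequences -/

section Sequence

set_option linter.unusedSectionVars false

variable {N : ℕ} [NeZero N] {X : Fin N → Type*} [∀ i, MeasurableSpace (X i)]
  {μ γ : ∀ i, Measure (X i)} [∀ i, IsFiniteMeasure (μ i)] [∀ i, IsFiniteMeasure (γ i)]
  {φ : Fin N → ℝ → EReal} {c : (∀ i, X i) → ℝ} {ε C L : ℝ} {F : ℕ → ∀ i, X i → ℝ}

/-- `F` is a sequence of cyclic Sinkhorn steps. -/
def IsSinkhornSeq (μ γ : ∀ i, Measure (X i)) (φ : Fin N → ℝ → EReal) (c : (∀ i, X i) → ℝ)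
    (ε : ℝ) (F : ℕ → ∀ i, X i → ℝ) : Prop :=
  ∀ n, F (n + 1) = sinkhornStep μ γ φ c ε (F n) (Fin.ofNat N n)

theorem IsSinkhornSeq.exists_essBdd (S : Setting μ γ φ c ε C L)
    (hF : IsSinkhornSeq μ γ φ c ε F) (h0 : ∃ M, EssBdd γ M (F 0)) (n : ℕ) :
    ∃ M, EssBdd γ M (F n) := by
  induction n with
  | zero => exact h0
  | succ n ih =>
    obtain ⟨M, hM⟩ := ih
    rw [hF n]
    exact ⟨_, essBdd_sinkhornStep S hM _⟩

theorem exists_essBdd_of_lt (h : ∀ n, ∃ M, EssBdd γ M (F n)) (k : ℕ) :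
    ∃ M, ∀ n < k, EssBdd γ M (F n) := by
  choose M hM using h
  refine ⟨∑ n ∈ Finset.range k, |M n|, fun n hn => (hM n).mono ((le_abs_self _).trans ?_)⟩
  exact Finset.single_le_sum (f := fun n => |M n|) (fun _ _ => abs_nonneg _)
    (Finset.mem_range.2 hn)

theorem IsSinkhornSeq.step_apply_of_ne (hF : IsSinkhornSeq μ γ φ c ε F) {n : ℕ} {j : Fin N}
    (h : n % N ≠ j) : F (n + 1) j = F n j := by
  rw [hF n]
  exact Function.update_of_ne (fun e => h (by rw [e]; rfl)) _ _

theorem IsSinkhornSeq.step_apply_of_eq (hF : IsSinkhornSeq μ γ φ c ε F) {n : ℕ} {j : Fin N}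
    (h : n % N = j) : F (n + 1) = sinkhornStep μ γ φ c ε (F n) j := by
  have : Fin.ofNat N n = j := Fin.ext h
  rw [hF n, this]

/-- From step `j + 1` on, the coordinate `j` lies in the range of the Sinkhorn mapping. -/
theorem IsSinkhornSeq.exists_eq_sinkhornMap (hF : IsSinkhornSeq μ γ φ c ε F) (j : Fin N) {n : ℕ}
    (hn : (j : ℕ) < n) : ∃ m, F n j = sinkhornMap μ γ φ c ε (F m) j := by
  induction n with
  | zero => omega
  | succ n ih =>
    by_cases h : n % N = j
    · exact ⟨n, by rw [hF.step_apply_of_eq h]; exact Function.update_self ..⟩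
    · have hjn : (j : ℕ) < n := by
        rcases Nat.lt_succ_iff_lt_or_eq.1 hn with h1 | h1
        · exact h1
        · exact absurd (by rw [← h1]; exact Nat.mod_eq_of_lt j.2) h
      rw [hF.step_apply_of_ne h]
      exact ih hjn

/-- During the `r`-th cycle a coordinate stays fixed after its update. -/
theorem IsSinkhornSeq.apply_cycle (hF : IsSinkhornSeq μ γ φ c ε F) (r : ℕ) (j : Fin N) {n : ℕ}
    (h1 : r * N + j + 1 ≤ n) (h2 : n ≤ r * N + N) : F n j = F (r * N + j + 1) j := by
  induction n, h1 using Nat.le_induction with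
  | base => rfl
  | succ n hn ih =>
    rw [← ih (by omega)]
    refine hF.step_apply_of_ne fun h => ?_
    obtain ⟨k, rfl⟩ := Nat.exists_eq_add_of_le (show r * N ≤ n by omega)
    rw [add_comm, Nat.add_mul_mod_self_right, Nat.mod_eq_of_lt (by omega)] at h
    omega

theorem IsSinkhornSeq.admissible (S : Setting μ γ φ c ε C L) (hF : IsSinkhornSeq μ γ φ c ε F)
    (hb : ∀ n, ∃ M, EssBdd γ M (F n)) {M : ℝ} {n : ℕ} (hn : N ≤ n) (hM : EssBdd γ M (F n)) :
    Admissible μ γ φ M (F n) := by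
  refine ⟨hM, fun j => ?_⟩
  obtain ⟨m, hm⟩ := hF.exists_eq_sinkhornMap j (j.2.trans_le hn)
  obtain ⟨M', hM'⟩ := hb m
  rw [hm]
  exact ⟨ae_of_all _ fun t => neg_sinkhornMap_mem_dom S _ j t,
    integrable_penalty_sinkhornMap S hM' j⟩

theorem IsSinkhornSeq.realDual_add_le (S : Setting μ γ φ c ε C L)
    (hF : IsSinkhornSeq μ γ φ c ε F) (hb : ∀ n, ∃ M, EssBdd γ M (F n)) {n : ℕ} (hn : N ≤ n) :
    realDual μ γ φ c ε (F n) + ε * ∫ x, (plan c (2 * ε) (F n) x -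
        plan c (2 * ε) (F (n + 1)) x) ^ 2 ∂Measure.pi γ ≤ realDual μ γ φ c ε (F (n + 1)) := by
  obtain ⟨M, hM⟩ := hb n
  rw [hF n]
  exact realDual_add_sq_le_sinkhornStep S (hF.admissible S hb hn hM) _

theorem IsSinkhornSeq.realDual_mono (S : Setting μ γ φ c ε C L)
    (hF : IsSinkhornSeq μ γ φ c ε F) (hb : ∀ n, ∃ M, EssBdd γ M (F n)) :
    Monotone fun n => realDual μ γ φ c ε (F (n + N)) := by
  refine monotone_nat_of_le_succ fun n => ?_
  have h1 := hF.realDual_add_le S hb (n := n + N) (by omega)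
  have h2 : 0 ≤ ε * ∫ x, (plan c (2 * ε) (F (n + N)) x -
        plan c (2 * ε) (F (n + N + 1)) x) ^ 2 ∂Measure.pi γ :=
    mul_nonneg S.eps_pos.le (integral_nonneg fun x => sq_nonneg _)
  rw [show n + 1 + N = n + N + 1 by omega]
  linarith

/-- The iterates are uniformly bounded, by coercivity of the dual functional. -/
theorem IsSinkhornSeq.exists_forall_essBdd (S : Setting μ γ φ c ε C L)
    (hF : IsSinkhornSeq μ γ φ c ε F) (hb : ∀ n, ∃ M, EssBdd γ M (F n)) {A B D : ℝ} (hA : 0 < A)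
    (hAB : A < B) (hgrow : ∀ i, ∀ q ∈ dom (conj (φ i)),
      -((μ i).real Set.univ * (conj (φ i) q).toReal) ≤ min (A * -q) (B * -q) + D) :
    ∃ M, ∀ n, EssBdd γ M (F n) := by
  set K := |ε * L + C| with hK
  obtain ⟨M₁, hM₁⟩ := exists_abs_center_le S hA hAB hgrow (abs_nonneg (ε * L + C))
    (realDual μ γ φ c ε (F N))
  obtain ⟨M₂, hM₂⟩ := exists_essBdd_of_lt hb N
  refine ⟨max M₂ (M₁ + K), fun n => ?_⟩
  rcases lt_or_ge n N with hn | hn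
  · exact (hM₂ n hn).mono (le_max_left _ _)
  obtain ⟨M, hM⟩ := hb n
  have hadm := hF.admissible S hb hn hM
  have hcen : ∀ j, ∃ a : ℝ, ∀ᵐ t ∂γ j, |F n j t - a| ≤ K := fun j => by
    obtain ⟨m, hm⟩ := hF.exists_eq_sinkhornMap j (j.2.trans_le hn)
    obtain ⟨M', hM'⟩ := hb m
    obtain ⟨a, ha⟩ := exists_abs_sinkhornMap_sub_le S hM' j
    rw [hm]
    exact ⟨a, ha.mono fun t ht => ht.trans (le_abs_self _)⟩
  choose a ha using hcen
  have hd : realDual μ γ φ c ε (F N) ≤ realDual μ γ φ c ε (F n) := by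
    have := hF.realDual_mono S hb (show 0 ≤ n - N by omega)
    simpa [Nat.sub_add_cancel hn] using this
  have hbound := hM₁ M (F n) a hadm ha hd
  refine fun j => ⟨(hM j).1, ?_⟩
  filter_upwards [ha j] with t ht
  have h1 := abs_sub_abs_le_abs_sub (F n j t) (a j)
  exact le_max_of_le_right (by linarith [hbound j])

/-- The limit of the dual functional along the iterates, written as the supremum over the iterates
whose coordinates have all been updated; the functional may be infinite at earlier ones. -/
def limitValue (μ γ : ∀ i, Measure (X i)) (φ : Fin N → ℝ → EReal) (c : (∀ i, X i) → ℝ)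
    (ε : ℝ) (F : ℕ → ∀ i, X i → ℝ) : ℝ :=
  ⨆ n, realDual μ γ φ c ε (F (n + N))

theorem IsSinkhornSeq.bddAbove (S : Setting μ γ φ c ε C L) (hF : IsSinkhornSeq μ γ φ c ε F)
    {M : ℝ} (hM : ∀ n, EssBdd γ M (F n)) :
    BddAbove (Set.range fun n => realDual μ γ φ c ε (F (n + N))) := by
  refine ⟨_, Set.forall_mem_range.2 fun n => realDual_le S
    (hF.admissible S (fun n => ⟨M, hM n⟩) (by omega) (hM (n + N)))⟩

theorem IsSinkhornSeq.tendsto_realDual (S : Setting μ γ φ c ε C L)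
    (hF : IsSinkhornSeq μ γ φ c ε F) {M : ℝ} (hM : ∀ n, EssBdd γ M (F n)) :
    Tendsto (fun n => realDual μ γ φ c ε (F n)) atTop (𝓝 (limitValue μ γ φ c ε F)) := by
  rw [← tendsto_add_atTop_iff_nat N]
  exact tendsto_atTop_ciSup (hF.realDual_mono S fun n => ⟨M, hM n⟩) (hF.bddAbove S hM)

theorem IsSinkhornSeq.realDual_le_limitValue (S : Setting μ γ φ c ε C L)
    (hF : IsSinkhornSeq μ γ φ c ε F) {M : ℝ} (hM : ∀ n, EssBdd γ M (F n)) {n : ℕ} (hn : N ≤ n) :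
    realDual μ γ φ c ε (F n) ≤ limitValue μ γ φ c ε F := by
  have := le_ciSup (hF.bddAbove S hM) (n - N)
  simp only [Nat.sub_add_cancel hn] at this
  exact this

/-- Consecutive plans become close, because the dual functional converges. -/
theorem IsSinkhornSeq.tendsto_integral_abs_plan_sub_succ (S : Setting μ γ φ c ε C L)
    (hF : IsSinkhornSeq μ γ φ c ε F) {M : ℝ} (hM : ∀ n, EssBdd γ M (F n)) :
    Tendsto (fun n => ∫ x, |plan c ε (F n) x - plan c ε (F (n + 1)) x| ∂Measure.pi γ) atTop
      (𝓝 0) := by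
  have hε := S.eps_pos
  refine tendsto_integral_abs_plan_sub S hM (fun n => hM (n + 1)) ?_
  have h1 := hF.tendsto_realDual S hM
  have h2 : Tendsto (fun n => (realDual μ γ φ c ε (F (n + 1)) - realDual μ γ φ c ε (F n)) / ε)
      atTop (𝓝 0) := by
    have := (((tendsto_add_atTop_iff_nat 1).2 h1).sub h1).div_const ε
    simpa using this
  refine tendsto_of_tendsto_of_tendsto_of_le_of_le' tendsto_const_nhds h2
    (Eventually.of_forall fun n => integral_nonneg fun x => sq_nonneg _) ?_
  filter_upwards [eventually_ge_atTop N] with n hn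
  have := hF.realDual_add_le S (fun n => ⟨M, hM n⟩) hn
  rw [le_div_iff₀ hε]
  linarith

/-- Triangle inequality along consecutive iterates. -/
theorem integral_abs_plan_sub_le_sum (S : Setting μ γ φ c ε C L) {M : ℝ}
    (hM : ∀ n, EssBdd γ M (F n)) (a k : ℕ) :
    ∫ x, |plan c ε (F a) x - plan c ε (F (a + k)) x| ∂Measure.pi γ ≤
      ∑ i ∈ Finset.range k,
        ∫ x, |plan c ε (F (a + i)) x - plan c ε (F (a + i + 1)) x| ∂Measure.pi γ := by
  have hp := fun n => integrable_plan S.eps_pos S.measurable_cost S.abs_cost_le (hM n)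
  induction k with
  | zero => simp
  | succ k ih =>
    rw [Finset.sum_range_succ]
    refine le_trans ?_ (add_le_add_left ih _)
    have hd : ∀ m n, Integrable (fun x => |plan c ε (F m) x - plan c ε (F n) x|) (Measure.pi γ) :=
      fun m n => ((hp m).sub (hp n)).abs
    rw [← integral_add (hd _ _) (hd _ _)]
    exact integral_mono (hd _ _) ((hd _ _).add (hd _ _)) fun x => abs_sub_le _ _ _

/-- The iterates form a maximizing sequence. -/
theorem IsSinkhornSeq.realDual_le_limitValue_of_admissible (S : Setting μ γ φ c ε C L)
    (hF : IsSinkhornSeq μ γ φ c ε F) {M : ℝ} (hM : ∀ n, EssBdd γ M (F n)) {G : ℝ}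
    {g : ∀ i, X i → ℝ} (hg : Admissible μ γ φ G g) :
    realDual μ γ φ c ε g ≤ limitValue μ γ φ c ε F := by
  set d : ℕ → ℝ := fun n => ∫ x, |plan c ε (F n) x - plan c ε (F (n + 1)) x| ∂Measure.pi γ with hd
  have hd0 : ∀ n, 0 ≤ d n := fun n => integral_nonneg fun x => abs_nonneg _
  have hdlim : Tendsto d atTop (𝓝 0) := hF.tendsto_integral_abs_plan_sub_succ S hM
  have hN : 0 < N := Nat.pos_of_ne_zero (NeZero.ne N)
  have hE : Tendsto (fun r => ∑ i ∈ Finset.range N, d (r * N + i)) atTop (𝓝 0) := by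
    have : Tendsto (fun r => ∑ i ∈ Finset.range N, d (r * N + i)) atTop
        (𝓝 (∑ i ∈ Finset.range N, (0 : ℝ))) := by
      refine tendsto_finsetSum _ fun i _ => hdlim.comp ?_
      exact tendsto_atTop_mono (fun r => (Nat.le_mul_of_pos_right r hN).trans
        (Nat.le_add_right _ _)) tendsto_id
    simpa using this
  have hlim : Tendsto (fun r => limitValue μ γ φ c ε F +
      |G + M| * ∑ _j : Fin N, ∑ i ∈ Finset.range N, d (r * N + i)) atTop
      (𝓝 (limitValue μ γ φ c ε F + |G + M| * ∑ _j : Fin N, 0)) :=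
    tendsto_const_nhds.add ((tendsto_finsetSum _ fun _ _ => hE).const_mul _)
  rw [Finset.sum_const_zero, mul_zero, add_zero] at hlim
  refine ge_of_tendsto hlim (Eventually.of_forall fun r => ?_)
  have hf := hF.admissible S (fun n => ⟨M, hM n⟩) (n := r * N + N) (by omega) (hM (r * N + N))
  have hmod : ∀ j : Fin N, (r * N + j) % N = j := fun j => by
    rw [add_comm, Nat.add_mul_mod_self_right, Nat.mod_eq_of_lt j.2]
  have hstep : ∀ j : Fin N, F (r * N + j + 1) = sinkhornStep μ γ φ c ε (F (r * N + j)) j :=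
    fun j => hF.step_apply_of_eq (hmod j)
  have hle := realDual_le_add_of_sinkhornStep S hf hg (h := fun j => F (r * N + j))
    (fun j => hM _) fun j => by
      rw [← hstep j]
      exact (hF.apply_cycle r j (by have := j.2; omega) le_rfl).symm
  have hterm : ∀ j : Fin N, ∫ x, |plan c ε (sinkhornStep μ γ φ c ε (F (r * N + j)) j) x -
      plan c ε (F (r * N + N)) x| ∂Measure.pi γ ≤ ∑ i ∈ Finset.range N, d (r * N + i) := fun j => by
    have hj := j.2
    rw [← hstep j]
    have h1 := integral_abs_plan_sub_le_sum S hM (r * N + j + 1) (N - (j + 1))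
    rw [show r * N + j + 1 + (N - (j + 1)) = r * N + N by omega] at h1
    refine h1.trans ?_
    have h2 : ∑ i ∈ Finset.range (N - (j + 1)), d (r * N + j + 1 + i) =
        ∑ i ∈ Finset.Ico ((j : ℕ) + 1) N, d (r * N + i) := by
      rw [Finset.sum_Ico_eq_sum_range]
      exact Finset.sum_congr rfl fun i _ => by
        rw [show r * N + j + 1 + i = r * N + (j + 1 + i) by ring]
    change ∑ i ∈ Finset.range (N - (j + 1)), d (r * N + j + 1 + i) ≤ _
    rw [h2]
    refine Finset.sum_le_sum_of_subset_of_nonneg (fun i hi => ?_) fun i _ _ => hd0 _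
    rw [Finset.mem_Ico] at hi
    exact Finset.mem_range.2 hi.2
  have hsum := Finset.sum_le_sum fun j (_ : j ∈ Finset.univ) => hterm j
  have hnn : 0 ≤ ∑ j : Fin N, ∫ x, |plan c ε (sinkhornStep μ γ φ c ε (F (r * N + j)) j) x -
      plan c ε (F (r * N + N)) x| ∂Measure.pi γ :=
    Finset.sum_nonneg fun j _ => integral_nonneg fun x => abs_nonneg _
  have h1 := hF.realDual_le_limitValue S hM (n := r * N + N) (by omega)
  have h2 := mul_le_mul (le_abs_self (G + M)) hsum hnn (abs_nonneg (G + M))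
  linarith

theorem integrable_midGap (S : Setting μ γ φ c ε C L) {M : ℝ} {f g : ∀ i, X i → ℝ}
    (hf : Admissible μ γ φ M f) (hg : Admissible μ γ φ M g) (i : Fin N) :
    Integrable (fun t => midGap (fun q => (conj (φ i) q).toReal) (-f i t) (-g i t)) (μ i) := by
  have hadd : Integrable (fun t => penalty (φ i) (f i t) / 2 + penalty (φ i) (g i t) / 2) (μ i) :=
      ((hf.2 i).2.div_const 2).add ((hg.2 i).2.div_const 2)
  refine (hadd.sub ((hf.midpoint S hg).2 i).2).congr (ae_of_all _ fun t => ?_)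
  simp only [midGap, penalty, Pi.sub_apply]
  rw [show (-f i t + -g i t) / 2 = -((f i t + g i t) / 2) by ring]

theorem ae_midGap_nonneg (S : Setting μ γ φ c ε C L) {M : ℝ} {f g : ∀ i, X i → ℝ}
    (hf : Admissible μ γ φ M f) (hg : Admissible μ γ φ M g) (i : Fin N) :
    ∀ᵐ t ∂μ i, 0 ≤ midGap (fun q => (conj (φ i) q).toReal) (-f i t) (-g i t) := by
  filter_upwards [(S.ac i).ae_le (hf.2 i).1, (S.ac i).ae_le (hg.2 i).1] with t h1 h2
  exact midGap_nonneg (S.strict i).convexOn h1 h2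

/-- Nearly optimal potentials are close to each other: their midpoint would otherwise exceed the
supremum `v`, by strict convexity of the penalties. -/
theorem exists_integral_abs_sub_le (S : Setting μ γ φ c ε C L) (M : ℝ) {δ : ℝ} (hδ : 0 < δ) :
    ∃ K : ℝ, 0 ≤ K ∧ ∀ (v : ℝ) (f g : ∀ i, X i → ℝ), Admissible μ γ φ M f →
      Admissible μ γ φ M g → (∀ h, Admissible μ γ φ M h → realDual μ γ φ c ε h ≤ v) →
      ∀ i, ∫ t, |f i t - g i t| ∂μ i ≤
        δ + K * (v - (realDual μ γ φ c ε f + realDual μ γ φ c ε g) / 2) := by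
  classical
  have hm : ∀ i, 0 < (μ i).real Set.univ := marginal_real_univ_pos S
  choose K hK0 hK using fun i => exists_abs_sub_le_add_mul_midGap (S.strict i) M
    (div_pos hδ (hm i))
  refine ⟨∑ i, K i, Finset.sum_nonneg fun i _ => hK0 i, fun v f g hf hg hv i => ?_⟩
  set gap : Fin N → ℝ := fun i =>
    ∫ t, midGap (fun q => (conj (φ i) q).toReal) (-f i t) (-g i t) ∂μ i with hgap
  have hgap0 : ∀ i, 0 ≤ gap i := fun i => integral_nonneg_of_ae (ae_midGap_nonneg S hf hg i)
  have h1 : ∫ t, |f i t - g i t| ∂μ i ≤ δ + K i * gap i := by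
    have h2 : ∫ t, |f i t - g i t| ∂μ i ≤ ∫ t, (δ / (μ i).real Set.univ + K i *
        midGap (fun q => (conj (φ i) q).toReal) (-f i t) (-g i t)) ∂μ i := by
      refine integral_mono_ae ((hf.1.integrable_marginal S i).sub
        (hg.1.integrable_marginal S i)).abs
        ((integrable_const _).add ((integrable_midGap S hf hg i).const_mul _)) ?_
      filter_upwards [(S.ac i).ae_le (hf.2 i).1, (S.ac i).ae_le (hg.2 i).1,
        (S.ac i).ae_le (hf.1 i).2, (S.ac i).ae_le (hg.1 i).2] with t a1 a2 a3 a4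
      have := hK i _ a1 _ a2 (by rwa [abs_neg]) (by rwa [abs_neg])
      rwa [neg_sub_neg, abs_sub_comm] at this
    rw [integral_add (integrable_const _) ((integrable_midGap S hf hg i).const_mul _),
      integral_const, integral_const_mul, smul_eq_mul, mul_div_cancel₀ _ (hm i).ne'] at h2
    exact h2
  have h3 := realDual_midpoint_ge S hf hg
  have h4 := hv _ (hf.midpoint S hg)
  have h5 : gap i ≤ v - (realDual μ γ φ c ε f + realDual μ γ φ c ε g) / 2 := by
    have : gap i ≤ ∑ k, gap k := Finset.single_le_sum (fun k _ => hgap0 k) (Finset.mem_univ i)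
    linarith
  have h6 : K i ≤ ∑ k, K k := Finset.single_le_sum (fun k _ => hK0 k) (Finset.mem_univ i)
  have h7 := mul_le_mul h6 h5 (hgap0 i) (Finset.sum_nonneg fun k _ => hK0 k)
  linarith

/-- The iterates form a Cauchy sequence in `L¹`. -/
theorem IsSinkhornSeq.cauchy (S : Setting μ γ φ c ε C L)
    (hF : IsSinkhornSeq μ γ φ c ε F) {M : ℝ} (hM : ∀ n, EssBdd γ M (F n)) (i : Fin N) {δ : ℝ}
    (hδ : 0 < δ) : ∃ n₀, ∀ n ≥ n₀, ∀ m ≥ n₀, ∫ t, |F n i t - F m i t| ∂γ i ≤ δ := by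
  -- `exp L` is lost in passing from `μ i` to `γ i`, and `δ'` occurs twice
  set δ' := δ / (2 * Real.exp L) with hδ'
  have hδ'0 : 0 < δ' := by positivity
  obtain ⟨K, hK0, hK⟩ := exists_integral_abs_sub_le S M hδ'0
  set v := limitValue μ γ φ c ε F
  have h1 := hF.tendsto_realDual S hM
  have hη : 0 < δ' / (K + 1) := by positivity
  obtain ⟨n₁, hn₁⟩ := eventually_atTop.1
    (h1.eventually_const_lt (show v - δ' / (K + 1) < v by linarith))
  refine ⟨max n₁ N, fun n hn m hm => ?_⟩
  have hn' := hn₁ n (le_of_max_le_left hn)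
  have hm' := hn₁ m (le_of_max_le_left hm)
  have hb : ∀ n, ∃ M, EssBdd γ M (F n) := fun n => ⟨M, hM n⟩
  have h2 := hK v (F n) (F m) (hF.admissible S hb (le_of_max_le_right hn) (hM n))
    (hF.admissible S hb (le_of_max_le_right hm) (hM m))
    (fun h hh => hF.realDual_le_limitValue_of_admissible S hM hh) i
  have h3 : K * (v - (realDual μ γ φ c ε (F n) + realDual μ γ φ c ε (F m)) / 2) ≤ δ' := by
    calc _ ≤ K * (δ' / (K + 1)) := mul_le_mul_of_nonneg_left (by linarith) hK0
      _ ≤ δ' := by rw [← mul_div_assoc, div_le_iff₀ (by positivity)]; nlinarith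
  have h4 := S.integral_reference_le i (h := fun t => |F n i t - F m i t|)
    (fun t => abs_nonneg _)
    (((hM n).integrable_marginal S i).sub ((hM m).integrable_marginal S i)).abs
  have h5 : Real.exp L * ∫ t, |F n i t - F m i t| ∂μ i ≤ Real.exp L * (2 * δ') :=
    mul_le_mul_of_nonneg_left (by linarith) (Real.exp_pos _).le
  have h6 : Real.exp L * (2 * δ') = δ := by rw [hδ']; field_simp
  linarith

/-- Maximizers of the real-valued dual functional agree almost everywhere. -/
theorem ae_eq_of_realDual_maximal (S : Setting μ γ φ c ε C L) {M : ℝ} {f g : ∀ i, X i → ℝ}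
    (hf : Admissible μ γ φ M f) (hg : Admissible μ γ φ M g)
    (hmax : ∀ h, Admissible μ γ φ M h → realDual μ γ φ c ε h ≤ realDual μ γ φ c ε f)
    (hfg : realDual μ γ φ c ε f ≤ realDual μ γ φ c ε g) (i : Fin N) : g i =ᵐ[γ i] f i := by
  have h0 : ∫ t, |f i t - g i t| ∂μ i = 0 := by
    refine le_antisymm (le_of_forall_pos_le_add fun δ hδ => ?_)
      (integral_nonneg fun t => abs_nonneg _)
    obtain ⟨K, hK0, hK⟩ := exists_integral_abs_sub_le S M hδ
    have h1 := hK _ f g hf hg hmax i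
    have h2 : K * (realDual μ γ φ c ε f - (realDual μ γ φ c ε f + realDual μ γ φ c ε g) / 2) ≤ 0 :=
      mul_nonpos_of_nonneg_of_nonpos hK0 (by linarith)
    linarith
  have h1 := (integral_eq_zero_iff_of_nonneg (fun t => abs_nonneg _)
    ((hf.1.integrable_marginal S i).sub (hg.1.integrable_marginal S i)).abs).1 h0
  refine (S.reference_ac i).ae_le ?_
  filter_upwards [h1] with t ht
  have : |f i t - g i t| = 0 := ht
  rw [abs_eq_zero] at this
  linarith

end Sequence

/-! ### The limit of the iterates -/

section Limit

set_option linter.unusedSectionVars false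

variable {N : ℕ} [NeZero N] {X : Fin N → Type*} [∀ i, MeasurableSpace (X i)]
  {μ γ : ∀ i, Measure (X i)} [∀ i, IsFiniteMeasure (μ i)] [∀ i, IsFiniteMeasure (γ i)]
  {φ : Fin N → ℝ → EReal} {c : (∀ i, X i) → ℝ} {ε C L : ℝ} {F : ℕ → ∀ i, X i → ℝ}

/-- Along the iterates the penalties satisfy a one-sided Lipschitz estimate, since subgradients of
`φ_i^*` at the iterates are uniformly bounded. -/
theorem IsSinkhornSeq.exists_penalty_le (S : Setting μ γ φ c ε C L)
    (hF : IsSinkhornSeq μ γ φ c ε F) {M : ℝ} (hM : ∀ n, EssBdd γ M (F n)) (i : Fin N) :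
    ∃ R : ℝ, 0 ≤ R ∧ ∀ᵐ t ∂γ i, ∀ n ≥ N, ∀ m ≥ N, -F n i t ∈ dom (conj (φ i)) ∧
      penalty (φ i) (F m i t) ≤ penalty (φ i) (F n i t) + R * |F n i t - F m i t| := by
  refine ⟨Real.exp ((sinkhornBound γ φ ε C L M i + transformBound γ ε C L M i) / ε),
    (Real.exp_pos _).le, ?_⟩
  filter_upwards [ae_all_iff.2 fun n => sinkhornSlope_le S (hM n) i] with t ht n hn m hm
  obtain ⟨n', hn'⟩ := hF.exists_eq_sinkhornMap i (i.2.trans_le hn)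
  obtain ⟨m', hm'⟩ := hF.exists_eq_sinkhornMap i (i.2.trans_le hm)
  have hdn : -F n i t ∈ dom (conj (φ i)) := hn' ▸ neg_sinkhornMap_mem_dom S _ i t
  refine ⟨hdn, ?_⟩
  have h1 := sinkhornSlope_subgradient S (F m') i t hdn
  rw [← hm'] at h1
  change penalty (φ i) (F m i t) - _ ≤ penalty (φ i) (F n i t) at h1
  have h2 : sinkhornSlope μ γ φ c ε (F m') i t * (F n i t - F m i t) ≤
      Real.exp ((sinkhornBound γ φ ε C L M i + transformBound γ ε C L M i) / ε) *
        |F n i t - F m i t| :=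
    (mul_le_mul_of_nonneg_left (le_abs_self _) (Real.exp_pos _).le).trans
      (mul_le_mul_of_nonneg_right (ht m') (abs_nonneg _))
  linarith

/-- The estimate passes to limits, as `φ^*` is a supremum of affine functions. -/
theorem penalty_le_of_tendsto {φ : ℝ → EReal} (hφ : IsEntropyFunction φ) {x : ℕ → ℝ} {a b R y : ℝ}
    (hdom : ∀ k, -x k ∈ dom (conj φ)) (hx : Tendsto x atTop (𝓝 y))
    (hle : ∀ k, penalty φ (x k) ≤ a + R * |b - x k|) :
    -y ∈ dom (conj φ) ∧ penalty φ y ≤ a + R * |b - y| := by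
  have hconj : conj φ (-y) ≤ ((a + R * |b - y| : ℝ) : EReal) := by
    rw [conj_le_coe_iff hφ]
    intro z hz
    have h1 : ∀ k, -x k * z - (φ z).toReal ≤ a + R * |b - x k| := fun k => by
      refine le_trans ?_ (hle k)
      exact (conj_le_coe_iff hφ).1 (coe_toReal_conj (hdom k)).ge z hz
    exact le_of_tendsto_of_tendsto' ((hx.neg.mul_const z).sub_const _)
      (((tendsto_const_nhds.sub hx).abs.const_mul R).const_add a) h1
  have hd : -y ∈ dom (conj φ) :=
    (mem_dom_conj_iff hφ).2 (ne_top_of_le_ne_top (EReal.coe_ne_top _) hconj)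
  rw [← coe_toReal_conj hd] at hconj
  exact ⟨hd, by exact_mod_cast hconj⟩

/-- The iterates converge in `L¹`, and the limit attains the supremum of the dual functional. -/
theorem IsSinkhornSeq.exists_limit (S : Setting μ γ φ c ε C L)
    (hF : IsSinkhornSeq μ γ φ c ε F) {M : ℝ} (hM : ∀ n, EssBdd γ M (F n)) :
    ∃ f : ∀ i, X i → ℝ, Admissible μ γ φ M f ∧
      limitValue μ γ φ c ε F ≤ realDual μ γ φ c ε f ∧
      ∀ i, Tendsto (fun n => ∫ t, |F n i t - f i t| ∂γ i) atTop (𝓝 0) := by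
  choose f hfm hfM hflim ns hns hfae using fun i => exists_limit_of_cauchy
    (h := fun n => F n i) (fun n => (hM n i).1) (fun n => (hM n i).2)
    (fun δ hδ => hF.cauchy S hM i hδ)
  have hfb : EssBdd γ M f := fun i => ⟨hfm i, hfM i⟩
  choose R hR0 hR using fun i => hF.exists_penalty_le S hM i
  have hpt : ∀ i, ∀ᵐ t ∂γ i, -f i t ∈ dom (conj (φ i)) ∧ ∀ n ≥ N,
      penalty (φ i) (f i t) ≤ penalty (φ i) (F n i t) + R i * |F n i t - f i t| := by
    intro i
    filter_upwards [hR i, hfae i] with t h1 h2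
    have h3 : Tendsto (fun k => F (ns i (k + N)) i t) atTop (𝓝 (f i t)) :=
      (tendsto_add_atTop_iff_nat (f := fun k => F (ns i k) i t) N).2 h2
    have hge : ∀ k, N ≤ ns i (k + N) := fun k => by
      have := (hns i).id_le (k + N)
      simp only [id] at this
      omega
    have h4 : ∀ n ≥ N, _ := fun n hn => penalty_le_of_tendsto (S.entropy i)
      (a := penalty (φ i) (F n i t)) (b := F n i t) (R := R i)
      (fun k => (h1 _ (hge k) n hn).1) h3 (fun k => (h1 n hn _ (hge k)).2)
    exact ⟨(h4 N le_rfl).1, fun n hn => (h4 n hn).2⟩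
  have hb : ∀ n, ∃ M, EssBdd γ M (F n) := fun n => ⟨M, hM n⟩
  have hdiff : ∀ n i, Integrable (fun t => |F n i t - f i t|) (μ i) := fun n i =>
    (((hM n).integrable_marginal S i).sub (hfb.integrable_marginal S i)).abs
  have hfadm : Admissible μ γ φ M f := by
    refine ⟨hfb, fun i => ⟨(hpt i).mono fun t ht => ht.1, ?_⟩⟩
    have hN := (hF.admissible S hb le_rfl (hM N)).2 i
    refine Integrable.mono' ((hN.2.abs.add ((hdiff N i).const_mul (R i))).add (integrable_const M))
      (aestronglyMeasurable_penalty S (hfm i)) ?_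
    filter_upwards [(S.ac i).ae_le (hpt i), (S.ac i).ae_le (hfM i)] with t h1 h2
    have h3 := neg_le_penalty (S.entropy i) h1.1
    have h4 := h1.2 N le_rfl
    have h5 := le_abs_self (penalty (φ i) (F N i t))
    have h6 := abs_nonneg (penalty (φ i) (F N i t))
    have h7 := mul_nonneg (hR0 i) (abs_nonneg (F N i t - f i t))
    have h8 := (abs_nonneg _).trans h2
    simp only [Pi.add_apply]
    rw [Real.norm_eq_abs, abs_le]
    constructor <;> linarith [(abs_le.1 h2).2]
  refine ⟨f, hfadm, ?_, hflim⟩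
  obtain ⟨T, hT⟩ := exists_abs_integral_plan_sub_le S M
  set e : ℕ → Fin N → ℝ := fun n i => ∫ t, |F n i t - f i t| ∂γ i with he
  have he0 : ∀ n i, 0 ≤ e n i := fun n i => integral_nonneg fun t => abs_nonneg _
  have hbound : ∀ n ≥ N, realDual μ γ φ c ε (F n) ≤ realDual μ γ φ c ε f +
      (∑ i, R i * (Real.exp L * e n i) + ε * (T * ∑ i, e n i)) := by
    intro n hn
    have hadm := hF.admissible S hb hn (hM n)
    have h1 : ∀ i, ∫ t, penalty (φ i) (f i t) ∂μ i ≤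
        ∫ t, penalty (φ i) (F n i t) ∂μ i + R i * (Real.exp L * e n i) := by
      intro i
      have h2 : ∫ t, penalty (φ i) (f i t) ∂μ i ≤
          ∫ t, (penalty (φ i) (F n i t) + R i * |F n i t - f i t|) ∂μ i := by
        refine integral_mono_ae (hfadm.2 i).2 ((hadm.2 i).2.add ((hdiff n i).const_mul _)) ?_
        filter_upwards [(S.ac i).ae_le (hpt i)] with t ht
        exact ht.2 n hn
      rw [integral_add (hadm.2 i).2 ((hdiff n i).const_mul _), integral_const_mul] at h2
      have h3 := S.integral_le_reference i (h := fun t => |F n i t - f i t|)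
        (fun t => abs_nonneg _) (((hM n).integrable i).sub (hfb.integrable i)).abs
      exact h2.trans (add_le_add_right (mul_le_mul_of_nonneg_left h3 (hR0 i)) _)
    have h4 := Finset.sum_le_sum fun i (_ : i ∈ Finset.univ) => h1 i
    rw [Finset.sum_add_distrib] at h4
    have h5 := mul_le_mul_of_nonneg_left ((neg_le_abs _).trans (hT (F n) f (hM n) hfb))
      S.eps_pos.le
    rw [realDual_eq S (hM n), realDual_eq S hfb]
    linarith
  have hlim : Tendsto (fun n => realDual μ γ φ c ε f +
      (∑ i, R i * (Real.exp L * e n i) + ε * (T * ∑ i, e n i))) atTop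
      (𝓝 (realDual μ γ φ c ε f + (∑ i : Fin N, R i * (Real.exp L * 0) +
        ε * (T * ∑ i : Fin N, 0)))) :=
    tendsto_const_nhds.add ((tendsto_finsetSum _ fun i _ =>
      ((hflim i).const_mul (Real.exp L)).const_mul (R i)).add
      (((tendsto_finsetSum _ fun i _ => hflim i).const_mul T).const_mul ε))
  simp only [mul_zero, Finset.sum_const_zero, add_zero] at hlim
  exact le_of_tendsto_of_tendsto (hF.tendsto_realDual S hM) hlim
    (eventually_atTop.2 ⟨N, hbound⟩)

theorem EssBdd.memLinfty {M : ℝ} {f : ∀ i, X i → ℝ} (hf : EssBdd γ M f) : MemLinfty γ f :=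
  fun i => memLp_top_of_bound (hf i).1 M (by simpa only [Real.norm_eq_abs] using (hf i).2)

theorem ae_abs_le_of_memLp_top {α : Type*} [MeasurableSpace α] {ν : Measure α} {h : α → ℝ}
    (hh : MemLp h ∞ ν) : ∀ᵐ t ∂ν, |h t| ≤ (eLpNorm h ∞ ν).toReal := by
  have h1 := hh.2.ne
  rw [eLpNorm_exponent_top] at h1 ⊢
  filter_upwards [ae_le_eLpNormEssSup (f := h) (μ := ν)] with t ht
  have := ENNReal.toReal_mono h1 ht
  simpa using this

theorem MemLinfty.exists_essBdd {f : ∀ i, X i → ℝ} (hf : MemLinfty γ f) : ∃ M, EssBdd γ M f := by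
  refine ⟨∑ i, (eLpNorm (f i) ∞ (γ i)).toReal, fun i => ⟨(hf i).1, ?_⟩⟩
  filter_upwards [ae_abs_le_of_memLp_top (hf i)] with t ht
  exact ht.trans (Finset.single_le_sum (f := fun i => (eLpNorm (f i) ∞ (γ i)).toReal)
    (fun _ _ => ENNReal.toReal_nonneg) (Finset.mem_univ i))

/-- Admissible potentials that maximize the real-valued functional are dual maximizers. -/
theorem isDualMaximizer_of_realDual (S : Setting μ γ φ c ε C L) {M : ℝ} {f : ∀ i, X i → ℝ}
    (hf : Admissible μ γ φ M f)
    (hmax : ∀ G h, Admissible μ γ φ G h → realDual μ γ φ c ε h ≤ realDual μ γ φ c ε f) :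
    IsDualMaximizer μ γ φ c ε f := by
  refine ⟨hf.1.memLinfty, fun g hg => ?_⟩
  obtain ⟨G, hG⟩ := hg.exists_essBdd
  rw [dualFunctional_eq_coe S hf]
  by_cases hd : dualFunctional μ γ φ c ε g = ⊥
  · rw [hd]; exact bot_le
  · have hadm := admissible_of_dualFunctional_ne_bot S hG hd
    rw [dualFunctional_eq_coe S hadm]
    exact_mod_cast hmax G g hadm

theorem ae_eq_of_isDualMaximizer (S : Setting μ γ φ c ε C L) {M : ℝ} {f g : ∀ i, X i → ℝ}
    (hf : Admissible μ γ φ M f)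
    (hmax : ∀ G h, Admissible μ γ φ G h → realDual μ γ φ c ε h ≤ realDual μ γ φ c ε f)
    (hg : IsDualMaximizer μ γ φ c ε g) (i : Fin N) : g i =ᵐ[γ i] f i := by
  obtain ⟨G, hG⟩ := hg.1.exists_essBdd
  have hle := hg.2 f hf.1.memLinfty
  rw [dualFunctional_eq_coe S hf] at hle
  have hadm := admissible_of_dualFunctional_ne_bot S hG
    fun h => EReal.coe_ne_bot _ (le_bot_iff.1 (h ▸ hle))
  rw [dualFunctional_eq_coe S hadm] at hle
  exact ae_eq_of_realDual_maximal S (hf.mono (le_max_left M G)) (hadm.mono (le_max_right M G))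
    (fun h hh => hmax _ h hh) (by exact_mod_cast hle) i

end Limit

end UMOT

end

theorem mainTheorem1 {N : ℕ} [NeZero N] {X : Fin N → Type*}
    [∀ i, TopologicalSpace (X i)] [∀ i, CompactSpace (X i)] [∀ i, PolishSpace (X i)]
    [∀ i, Nonempty (X i)] [∀ i, MeasurableSpace (X i)] [∀ i, BorelSpace (X i)]
    (μ γ : ∀ i, Measure (X i)) [∀ i, IsFiniteMeasure (μ i)] [∀ i, IsFiniteMeasure (γ i)]
    [∀ i, (μ i).IsOpenPosMeasure]
    (c : C((∀ i, X i), ℝ)) (_hc : ∀ x, 0 ≤ c x)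
    (φ : Fin N → ℝ → EReal) (hφ : ∀ i, UMOT.IsEntropyFunction (φ i))
    (ε : ℝ) (hε : 0 < ε)
    -- `ln (dμ_i/dγ_i) ∈ L^∞(X_i, γ_i)`; positivity is stated since `Real.log 0 = 0`
    (hμγ : ∀ i, μ i ≪ γ i)
    (hpos : ∀ i, ∀ᵐ x ∂(γ i), 0 < (μ i).rnDeriv (γ i) x)
    (hlog : ∀ i, MemLp (fun x => Real.log ((μ i).rnDeriv (γ i) x).toReal) ∞ (γ i))
    (hconv : ∀ i, UMOT.IsStrictlyConvex (UMOT.conj (φ i)))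
    (q p : Fin N → ℕ → ℝ)
    (hq : ∀ i n, q i n ∈ UMOT.dom (UMOT.conj (φ i)))
    (hp : ∀ i n, p i n ∈ UMOT.subdiff (UMOT.conj (φ i)) (q i n))
    (hlim : (∀ i, Tendsto (p i) atTop atTop) ∨
      (∀ i, Tendsto (p i) atTop (𝓝 0) ∧ ∃ m n, p i m ≠ p i n))
    (f₀ : ∀ i, X i → ℝ) (hf₀ : UMOT.MemLinfty γ f₀) :
    (∀ n, UMOT.MemLinfty γ (UMOT.sinkhornSeq μ γ φ c ε f₀ n)) ∧
    (∃ M : ℝ, ∀ n i, eLpNorm (UMOT.sinkhornSeq μ γ φ c ε f₀ n i) ∞ (γ i) ≤ ENNReal.ofReal M) ∧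
    ∃ f : ∀ i, X i → ℝ,
      UMOT.IsDualMaximizer μ γ φ c ε f ∧
      (∀ g : ∀ i, X i → ℝ, UMOT.IsDualMaximizer μ γ φ c ε g → ∀ i, g i =ᵐ[γ i] f i) ∧
      ∀ r : ℝ≥0∞, 1 ≤ r → r ≠ ∞ → ∀ i,
        Tendsto (fun n => eLpNorm (UMOT.sinkhornSeq μ γ φ c ε f₀ n i - f i) r (γ i))
          atTop (𝓝 0) := by
  have hcont : Measurable (c : (∀ i, X i) → ℝ) := c.continuous.measurable
  have hm0 : ∀ i, μ i ≠ 0 := fun i h =>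
    isOpen_univ.measure_ne_zero (μ i) Set.univ_nonempty (by rw [h]; rfl)
  -- the sum bounds all the logarithmic densities at once
  set L : ℝ := ∑ i, (eLpNorm (fun x => Real.log ((μ i).rnDeriv (γ i) x).toReal) ∞ (γ i)).toReal
  have hL : ∀ i, ∀ᵐ t ∂γ i, Real.exp (-L) ≤ ((μ i).rnDeriv (γ i) t).toReal ∧
      ((μ i).rnDeriv (γ i) t).toReal ≤ Real.exp L := fun i => by
    filter_upwards [UMOT.ae_abs_le_of_memLp_top (hlog i), hpos i,
      (μ i).rnDeriv_lt_top (γ i)] with t h1 h2 h3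
    have h4 : 0 < ((μ i).rnDeriv (γ i) t).toReal := ENNReal.toReal_pos h2.ne' h3.ne
    have h5 : |Real.log ((μ i).rnDeriv (γ i) t).toReal| ≤ L :=
      h1.trans (Finset.single_le_sum (f := fun i =>
        (eLpNorm (fun x => Real.log ((μ i).rnDeriv (γ i) x).toReal) ∞ (γ i)).toReal)
        (fun _ _ => ENNReal.toReal_nonneg) (Finset.mem_univ i))
    exact ⟨(Real.le_log_iff_exp_le h4).1 (abs_le.1 h5).1,
      (Real.log_le_iff_le_exp h4).1 (abs_le.1 h5).2⟩
  have S : UMOT.Setting μ γ φ c ε ‖c‖ L :=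
    { eps_pos := hε
      measurable_cost := hcont
      abs_cost_le := fun x => c.norm_coe_le_norm x
      entropy := hφ
      strict := hconv
      ac := hμγ
      density_ge := fun i => (hL i).mono fun _ h => h.1
      density_le := fun i => (hL i).mono fun _ h => h.2
      ne_zero := hm0 }
  have hF : UMOT.IsSinkhornSeq μ γ φ c ε (UMOT.sinkhornSeq μ γ φ c ε f₀) := fun n => rfl
  obtain ⟨A, B, D, hA, hAB, hgrow⟩ := UMOT.exists_neg_mul_toReal_conj_le_min hφ
    (UMOT.marginal_real_univ_pos S) hp (hlim.imp_right fun h i => (h i).1)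
  obtain ⟨M, hM⟩ := hF.exists_forall_essBdd S (hF.exists_essBdd S hf₀.exists_essBdd) hA hAB hgrow
  obtain ⟨f, hf, hmax, hconvg⟩ := hF.exists_limit S hM
  have hmax' : ∀ G h, UMOT.Admissible μ γ φ G h →
      UMOT.realDual μ γ φ c ε h ≤ UMOT.realDual μ γ φ c ε f := fun G h hh =>
    (hF.realDual_le_limitValue_of_admissible S hM hh).trans hmax
  refine ⟨fun n => (hM n).memLinfty, ⟨M, fun n i => ?_⟩, f,
    UMOT.isDualMaximizer_of_realDual S hf hmax',
    fun g hg i => UMOT.ae_eq_of_isDualMaximizer S hf hmax' hg i, fun r h1 hr i => ?_⟩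
  · rw [eLpNorm_exponent_top]
    exact eLpNormEssSup_le_of_ae_bound (by simpa only [Real.norm_eq_abs] using (hM n i).2)
  · refine UMOT.tendsto_eLpNorm_of_tendsto_integral (K := M + M)
      (fun n => (hM n i).1.sub (hf.1 i).1) (Eventually.of_forall fun n => ?_) (hconvg i) h1 hr
    filter_upwards [(hM n i).2, (hf.1 i).2] with t h1 h2
    exact (abs_sub _ _).trans (add_le_add h1 h2)
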